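/- **Setting.** For an odd prime power $q$, let $\mathbb F_q$ be the field with $q$ elements and, for $x\in\mathbb F_q^2$, put $\|x\|=x_1^2+x_2^2$. Only those $q$ are considered for which $3$ is a square in $\mathbb F_q$, and for every such field a radius $t=t_q\in\mathbb F_q\setminus\{0\}$ is fixed (arbitrarily). Write $S_t$ for the indicator function of $\{x\in\mathbb F_q^2:\|x\|=t\}$. For $f:\mathbb F_q^2\to\mathbb R$ let $\|f\|_p=\big(q^{-2}\sum_x|f(x)|^p\big)^{1/p}$ for $1\le p<\infty$ and $\|f\|_\infty=\max_x|f(x)|$. For a graph $G$ with ordered vertex set $\{1,\dots,n\}$ and edge set $\mathcal E(G)$ let $$\Lambda_G(f_1,\dots,f_n)=\frac1{\mathcal N(G)}\sum_{x^1,\dots,x^n\in\mathbb F_q^2}\ \prod_{(i,j)\in\mathcal E(G)}S_t(x^i-x^j)\ \prod_{l=1}^n f_l(x^l),$$ where $\mathcal N(G)$ is the number of $(x^1,\dots,x^n)\in(\mathbb F_q^2)^n$ with $\|x^i-x^j\|=t$ for every edge $\{i,j\}$ of $G$. For $1\le p_1,\dots,p_n\le\infty$ let $\Lambda_G(p_1,\dots,p_n)$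 be the smallest constant $C$ such that $$\Lambda_G(f_1,\dots,f_n)\le C\prod_{i=1}^n\|f_i\|_{p_i}\qquad(*)$$ for all functions $f_i:\mathbb F_q^2\to[0,\infty)$. Write $\Lambda_G(p_1,\dots,p_n)\lesssim1$ if $\Lambda_G(p_1,\dots,p_n)\le C$ with a constant $C$ independent of $q$, and $\Lambda_G(p_1,\dots,p_n)\lessapprox1$ if $(*)$ holds, with a constant $C$ independent of $q$, whenever all the $f_i$ are indicator functions of subsets of $\mathbb F_q^2$. Let $\delta(G)$ denote the minimum degree of $G$. The graphs considered are, up to the order of their vertices: for $n=3$, the triangle $K_3$ and the path $P_2$ with two edges; for $n=4$, the cycle $C_4$, $C_4$ + diagonal, the path $P_3$ with three edges, $K_3$ + tail (a triangle and a fourth vertex joined to exactly one vertex of it), and the $Y$-shape (one vertex joined to the three others). These are all the connected graphs on $3$ or $4$ vertices except $K_4$. **Theorem.** Let $n\in\{3,4\}$, let $G$ and $G'$ be graphs from this list on the same ordered vertex set $\{1,\dots,n\}$, with $G'$ a subgraph of $G$, and suppose that $\min\{\delta(G),2\}>\delta(G')$. Let $1\le p_1,\dots,p_n\le\infty$. 1.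 If $\Lambda_G(p_1,\dots,p_n)\lesssim1$, then $\Lambda_{G'}(p_1,\dots,p_n)\lesssim1$, except possibly in the following endpoint case: $G$ is $C_4$ + diagonal, $G'$ is $K_3$ + tail, $p_i=2$ at the three vertices of the triangle of $G'$, and $p_i=\infty$ at the end of the tail. 2. In that endpoint case, $\Lambda_{G'}(p_1,\dots,p_n)\lessapprox1$. -/

import Mathlib

open scoped ENNReal NNReal

/-- `‖x‖ = x₁² + ⋯ + x_d²` for `x ∈ F^d`. -/
def sqNorm {F : Type} [Field F] {d : ℕ} (x : Fin d → F) : F := ∑ i, x i ^ 2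

open Classical in
/-- The kernel `K(x, y) = S_t(x - y)`, where `S_t` is (the indicator function of) the sphere
`{x : ‖x‖ = t}`. -/
noncomputable def sphereKernel {F : Type} [Field F] {d : ℕ} (t : F) (x y : Fin d → F) : ℝ :=
  if sqNorm (x - y) = t then 1 else 0

/-- The norm `‖f‖_p`, `1 ≤ p ≤ ∞`, with respect to the normalized counting measure on `F^d`. -/
noncomputable def avgNorm {F : Type} [Field F] [Fintype F] {d : ℕ} (p : ℝ≥0∞)
    (f : (Fin d → F) → ℝ) : ℝ :=
  if p = ∞ then ⨆ x, |f x|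
  else (((Fintype.card F : ℝ) ^ d)⁻¹ * ∑ x, |f x| ^ p.toReal) ^ (1 / p.toReal)

/-- The normalizing factor `𝒩(G)`: the number of placements `(x¹, …, xⁿ)` of the vertices
of `G` in `F^d` for which the endpoints of each edge of `G` are at distance `t`. -/
noncomputable def numPlacements {F : Type} [Field F] (d : ℕ) (t : F) {n : ℕ}
    (G : SimpleGraph (Fin n)) : ℕ :=
  Nat.card {x : Fin n → Fin d → F // ∀ i j, G.Adj i j → sqNorm (x i - x j) = t}

open Classical in
/-- The multilinear form `Λ_G(f₁, …, f_n)` on functions on `F^d`; each edge `{i, j}` of `G`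
contributes one factor, as the pair `(i, j)` with `i < j`. -/
noncomputable def graphForm {F : Type} [Field F] [Fintype F] {d : ℕ} (t : F) {n : ℕ}
    (G : SimpleGraph (Fin n)) (f : Fin n → (Fin d → F) → ℝ) : ℝ :=
  (numPlacements d t G : ℝ)⁻¹ *
    ∑ x : Fin n → Fin d → F,
      (∏ e : Fin n × Fin n with e.1 < e.2 ∧ G.Adj e.1 e.2, sphereKernel t (x e.1) (x e.2)) *
        ∏ l, f l (x l)

/-- `Λ_G(f₁, …, f_n) ≤ C ∏ ‖f_i‖_{p_i}` for all non-negative functions `f_i` on `F^d`. -/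
def IsFormBound {F : Type} [Field F] [Fintype F] (d : ℕ) (t : F) {n : ℕ}
    (G : SimpleGraph (Fin n)) (p : Fin n → ℝ≥0∞) (C : ℝ≥0) : Prop :=
  ∀ f : Fin n → (Fin d → F) → ℝ, (∀ i x, 0 ≤ f i x) →
    graphForm t G f ≤ C * ∏ i, avgNorm (p i) (f i)

/-- `Λ_G(p₁, …, p_n)`: the smallest constant in the inequality above. -/
noncomputable def formNorm {F : Type} [Field F] [Fintype F] (d : ℕ) (t : F) {n : ℕ}
    (G : SimpleGraph (Fin n)) (p : Fin n → ℝ≥0∞) : ℝ≥0∞ :=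
  ⨅ (C : ℝ≥0) (_ : IsFormBound d t G p C), (C : ℝ≥0∞)

/-- The finite fields considered: odd order and, in dimension two, `3` is a square. -/
def IsAdmissibleField (d : ℕ) (F : Type) [Field F] : Prop :=
  ringChar F ≠ 2 ∧ (d = 2 → IsSquare (3 : F))

/-- `Λ_G(p₁, …, p_n) ≲ 1` in dimension `d`: the constants `Λ_G(p₁, …, p_n)` are bounded
uniformly in the finite field; `t F` is the radius used over the field `F`. -/
def FormBounded (d : ℕ) (t : ∀ (F : Type) [Field F] [Fintype F], F) {n : ℕ}
    (G : SimpleGraph (Fin n)) (p : Fin n → ℝ≥0∞) : Prop :=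
  ∃ C : ℝ≥0, 1 ≤ C ∧ ∀ (F : Type) [Field F] [Fintype F], IsAdmissibleField d F →
    formNorm d (t F) G p ≤ C

/-- `Λ_G(p₁, …, p_n) ⪅ 1`: the inequality `Λ_G(f₁, …, f_n) ≤ C ∏ ‖f_i‖_{p_i}` holds,
uniformly in the finite field, for the indicator functions `f_i` of all sets `E_i ⊆ F^d`. -/
def FormRestrictedBounded (d : ℕ) (t : ∀ (F : Type) [Field F] [Fintype F], F) {n : ℕ}
    (G : SimpleGraph (Fin n)) (p : Fin n → ℝ≥0∞) : Prop :=
  ∃ C : ℝ≥0, 1 ≤ C ∧ ∀ (F : Type) [Field F] [Fintype F], IsAdmissibleField d F →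
    ∀ E : Fin n → Set (Fin d → F),
      graphForm (t F) G (fun i => (E i).indicator 1) ≤
        C * ∏ i, avgNorm (p i) ((E i).indicator (1 : (Fin d → F) → ℝ))

/-- The triangle `K₃`. -/
def graphK3 : SimpleGraph (Fin 3) := .fromEdgeSet {s(0, 1), s(1, 2), s(2, 0)}

/-- The path `P₂` of length two. -/
def graphP2 : SimpleGraph (Fin 3) := .fromEdgeSet {s(0, 1), s(1, 2)}

/-- The four-cycle with a diagonal. -/
def graphC4Diag : SimpleGraph (Fin 4) :=
  .fromEdgeSet {s(0, 1), s(1, 2), s(2, 3), s(3, 0), s(0, 2)}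

/-- The four-cycle `C₄`. -/
def graphC4 : SimpleGraph (Fin 4) := .fromEdgeSet {s(0, 1), s(1, 2), s(2, 3), s(3, 0)}

/-- The path `P₃` of length three. -/
def graphP3 : SimpleGraph (Fin 4) := .fromEdgeSet {s(0, 1), s(1, 2), s(2, 3)}

/-- `K₃` + tail (the kite): the tail joins the third vertex to the fourth. -/
def graphK3Tail : SimpleGraph (Fin 4) := .fromEdgeSet {s(0, 1), s(1, 2), s(2, 0), s(2, 3)}

/-- The `Y`-shaped graph. -/
def graphY : SimpleGraph (Fin 4) := .fromEdgeSet {s(2, 0), s(2, 1), s(2, 3)}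

/-- `G` is, up to the order of its vertices, one of the (connected) graphs studied with three
or four vertices. -/
def IsStudiedGraph {n : ℕ} (G : SimpleGraph (Fin n)) : Prop :=
  Nonempty (graphK3 ≃g G) ∨ Nonempty (graphP2 ≃g G) ∨ Nonempty (graphC4Diag ≃g G) ∨
    Nonempty (graphC4 ≃g G) ∨ Nonempty (graphP3 ≃g G) ∨ Nonempty (graphK3Tail ≃g G) ∨
    Nonempty (graphY ≃g G)

/-- The exceptional endpoint: in some order of the vertices, `G` is `C₄` + diagonal, `G'` is
`K₃` + tail, and the exponents are `(2, 2, 2, ∞)`, with `∞` at the end of the tail. -/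
def IsExceptionalEndpoint {n : ℕ} (G G' : SimpleGraph (Fin n)) (p : Fin n → ℝ≥0∞) : Prop :=
  ∃ σ : Fin 4 ≃ Fin n, G.comap σ = graphC4Diag ∧ G'.comap σ = graphK3Tail ∧
    ∀ i, p (σ i) = (![2, 2, 2, ∞] : Fin 4 → ℝ≥0∞) i

/-- The infimum defining `formNorm` is attained, so it is the smallest constant. -/
theorem formNorm_le_coe_iff {F : Type} [Field F] [Fintype F] (d : ℕ) (t : F) {n : ℕ}
    (G : SimpleGraph (Fin n)) (p : Fin n → ℝ≥0∞) (C : ℝ≥0) :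
    formNorm d t G p ≤ C ↔ IsFormBound d t G p C := by
  refine ⟨fun h f hf => ?_, fun h => iInf₂_le C h⟩
  have hP : 0 ≤ ∏ i, avgNorm (p i) (f i) := by
    refine Finset.prod_nonneg fun i _ => ?_
    unfold avgNorm
    split_ifs
    · exact Real.iSup_nonneg fun x => abs_nonneg _
    · refine Real.rpow_nonneg (mul_nonneg (by positivity) ?_) _
      exact Finset.sum_nonneg fun x _ => Real.rpow_nonneg (abs_nonneg _) _
  have key : ∀ ε : ℝ≥0, 0 < ε →
      graphForm t G f ≤ ((C + ε : ℝ≥0) : ℝ) * ∏ i, avgNorm (p i) (f i) := by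
    intro ε hε
    have hlt : formNorm d t G p < ((C + ε : ℝ≥0) : ℝ≥0∞) :=
      lt_of_le_of_lt h (by exact_mod_cast lt_add_of_pos_right C hε)
    unfold formNorm at hlt
    simp only [iInf_lt_iff] at hlt
    obtain ⟨C', hC', hlt'⟩ := hlt
    refine (hC' f hf).trans (mul_le_mul_of_nonneg_right ?_ hP)
    exact_mod_cast (ENNReal.coe_lt_coe.mp hlt').le
  rcases hP.eq_or_lt with h0 | hpos
  · simpa [← h0] using key 1 one_pos
  · refine le_of_forall_pos_le_add fun δ hδ => ?_
    have hq : 0 < δ / ∏ i, avgNorm (p i) (f i) := div_pos hδ hpos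
    have := key (Real.toNNReal (δ / ∏ i, avgNorm (p i) (f i))) (Real.toNNReal_pos.mpr hq)
    rw [NNReal.coe_add, Real.coe_toNNReal _ hq.le, add_mul, div_mul_cancel₀ _ hpos.ne'] at this
    exact this

/-! Write a_i = 1/p_i. The degree condition says that G has minimum degree at least two (so it is
K₃, C₄ or C₄ + diagonal) and that G' has a vertex of degree one. Both are compared with one
polytope, `exponentRegion`: boundedness for G forces the vector a into it, and every vector in it is
good for G'.

Necessity. The form is tested on the indicator of the origin at the vertices in a set Z and of the
circle about the origin at the others. If such placements make up a proportion of order q⁻² of all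
placements of G, then 2∑_{i∈Z} a_i + ∑_{i∉Z} a_i ≤ 2. As the constant is uniform in the field, the
fields of characteristic three suffice; there two vertices of an equilateral triangle determine the
third, so the two vertices of degree two in C₄ + diagonal coincide and Z may contain both. The
resulting inequalities imply membership in the polytope.

Sufficiency. A non-negative function is at most its norm times the power φ^a of a density, and by
weighted AM-GM the good vectors a form a convex set, so only the vertices of the polytope matter. In
the graph of pairs at distance t every degree is comparable to q, and distinct points have at most
two common neighbours. This yields `sum_cube_le` (averaging from L^{3/2} to L³) and `triangle_sq_le`
(the triangle with three functions in L²). Each G' grows from a point or from K₃ by attaching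
leaves, which preserves the bounds by `VertexBound.attachLeaf`. The exceptional exponents are
themselves a vertex of the polytope, so the restricted bound there comes from the full one. -/

/-- A non-negative function whose average is at most one. -/
def IsDensity {V : Type*} [Fintype V] (φ : V → ℝ) : Prop :=
  (∀ x, 0 ≤ φ x) ∧ ∑ x, φ x ≤ Fintype.card V

/-- The multilinear form with weight `w` is bounded by `C` on the functions `φ i ^ a i`, where
the `φ i` are densities; this is the bound with exponents `p i = 1 / a i` by homogeneity. -/
def PowerBound {ι V : Type*} [Fintype ι] [DecidableEq ι] [Fintype V] (w : (ι → V) → ℝ)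
    (a : ι → ℝ) (C : ℝ) : Prop :=
  ∀ φ : ι → V → ℝ, (∀ i, IsDensity (φ i)) → ∑ x : ι → V, w x * ∏ i, φ i (x i) ^ a i ≤ C

/-- The exponent vector with entries `2 / (|s| + 1)` on `s` and zero elsewhere. -/
noncomputable def vertexExponent {ι : Type*} [DecidableEq ι] (s : Finset ι) (i : ι) : ℝ :=
  if i ∈ s then 2 / (s.card + 1) else 0

/-- Boundedness at all exponent vectors `vertexExponent s` with `|s| ≤ 3`. -/
def VertexBound {ι V : Type*} [Fintype ι] [DecidableEq ι] [Fintype V] (w : (ι → V) → ℝ)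
    (C : ℝ) : Prop :=
  ∀ s : Finset ι, s.card ≤ 3 → PowerBound w (vertexExponent s) C

/-- The convex hull of the exponent vectors `vertexExponent s` with `|s| ≤ 3`. -/
def exponentRegion (ι : Type*) [DecidableEq ι] : Set (ι → ℝ) :=
  convexHull ℝ (vertexExponent '' {s : Finset ι | s.card ≤ 3})

theorem isDensity_one {V : Type*} [Fintype V] : IsDensity (fun _ : V => (1 : ℝ)) :=
  ⟨fun _ => zero_le_one, by simp⟩

/-! ### Interpolation between exponent vectors -/

section PowerBound

variable {ι V : Type*} [Fintype ι] [DecidableEq ι] [Fintype V] {w : (ι → V) → ℝ}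

omit [Fintype ι] in
theorem vertexExponent_nonneg (s : Finset ι) : 0 ≤ vertexExponent s := by
  intro i
  unfold vertexExponent
  split_ifs
  · positivity
  · exact le_rfl

theorem PowerBound.mono {a : ι → ℝ} {C C' : ℝ} (h : PowerBound w a C) (hC : C ≤ C') :
    PowerBound w a C' :=
  fun φ hφ => (h φ hφ).trans hC

/-- With functions normalized as powers of densities, the summand at s • a + r • b is pointwise the
weighted geometric mean of the summands at a and b; AM-GM then keeps the constant C. Non-negative
exponents are needed to add exponents at points where a density vanishes. -/
theorem convex_powerBound (hw : ∀ x, 0 ≤ w x) (C : ℝ) :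
    Convex ℝ {a : ι → ℝ | 0 ≤ a ∧ PowerBound w a C} := by
  rintro a ⟨ha, hA⟩ b ⟨hb, hB⟩ s r hs hr hsr
  refine ⟨add_nonneg (smul_nonneg hs ha) (smul_nonneg hr hb), fun φ hφ => ?_⟩
  have key : ∀ x : ι → V, w x * ∏ i, φ i (x i) ^ (s • a + r • b) i ≤
      s * (w x * ∏ i, φ i (x i) ^ a i) + r * (w x * ∏ i, φ i (x i) ^ b i) := by
    intro x
    have h0 : ∀ i, 0 ≤ φ i (x i) := fun i => (hφ i).1 _
    have h1 : ∏ i, φ i (x i) ^ (s • a + r • b) i =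
        (∏ i, φ i (x i) ^ a i) ^ s * (∏ i, φ i (x i) ^ b i) ^ r := by
      rw [← Real.finsetProd_rpow _ _ fun i _ => Real.rpow_nonneg (h0 i) _,
        ← Real.finsetProd_rpow _ _ fun i _ => Real.rpow_nonneg (h0 i) _, ← Finset.prod_mul_distrib]
      refine Finset.prod_congr rfl fun i _ => ?_
      rw [← Real.rpow_mul (h0 i), ← Real.rpow_mul (h0 i), ← Real.rpow_add_of_nonneg (h0 i)
        (mul_nonneg (ha i) hs) (mul_nonneg (hb i) hr)]
      simp [mul_comm]
    have h2 := Real.geom_mean_le_arith_mean2_weighted hs hr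
      (Finset.prod_nonneg fun i (_ : i ∈ Finset.univ) => Real.rpow_nonneg (h0 i) (a i))
      (Finset.prod_nonneg fun i (_ : i ∈ Finset.univ) => Real.rpow_nonneg (h0 i) (b i)) hsr
    rw [h1]
    nlinarith [mul_le_mul_of_nonneg_left h2 (hw x)]
  calc _ ≤ ∑ x : ι → V, (s * (w x * ∏ i, φ i (x i) ^ a i) + r * (w x * ∏ i, φ i (x i) ^ b i)) :=
        Finset.sum_le_sum fun x _ => key x
    _ = s * (∑ x : ι → V, w x * ∏ i, φ i (x i) ^ a i) +
        r * ∑ x : ι → V, w x * ∏ i, φ i (x i) ^ b i := by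
        rw [Finset.sum_add_distrib, Finset.mul_sum, Finset.mul_sum]
    _ ≤ s * C + r * C :=
        add_le_add (mul_le_mul_of_nonneg_left (hA φ hφ) hs)
          (mul_le_mul_of_nonneg_left (hB φ hφ) hr)
    _ = C := by rw [← add_mul, hsr, one_mul]

theorem VertexBound.powerBound (hw : ∀ x, 0 ≤ w x) {C : ℝ} (h : VertexBound w C) {a : ι → ℝ}
    (ha : a ∈ exponentRegion ι) : PowerBound w a C := by
  have : exponentRegion ι ⊆ {a : ι → ℝ | 0 ≤ a ∧ PowerBound w a C} := by
    refine convexHull_min ?_ (convex_powerBound hw C)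
    rintro _ ⟨s, hs, rfl⟩
    exact ⟨vertexExponent_nonneg s, h s hs⟩
  exact (this ha).2

theorem VertexBound.mono {C C' : ℝ} (h : VertexBound w C) (hC : C ≤ C') : VertexBound w C' :=
  fun s hs => (h s hs).mono hC

omit [Fintype ι] in
theorem vertexExponent_mem_exponentRegion {s : Finset ι} (hs : s.card ≤ 3) :
    vertexExponent s ∈ exponentRegion ι :=
  subset_convexHull ℝ _ ⟨s, hs, rfl⟩

variable {κ : Type*} [Fintype κ] [DecidableEq κ]

theorem PowerBound.reindex (e : κ ≃ ι) {a : ι → ℝ} {C : ℝ}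
    (h : PowerBound (fun y : κ → V => w (y ∘ e.symm)) (a ∘ e) C) : PowerBound w a C := by
  intro φ hφ
  refine le_trans (le_of_eq ?_) (h (fun k => φ (e k)) fun k => hφ (e k))
  refine Fintype.sum_equiv (e.symm.arrowCongr (Equiv.refl V)) _ _ fun x => ?_
  congr 1
  · congr 1
    ext i
    simp [Equiv.arrowCongr]
  · refine (Fintype.prod_equiv e _ _ fun k => ?_).symm
    simp [Equiv.arrowCongr]

omit [Fintype ι] [Fintype κ] in
theorem vertexExponent_comp (e : κ ≃ ι) (s : Finset ι) :
    vertexExponent s ∘ e = vertexExponent (s.map e.symm.toEmbedding) := by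
  ext k
  simp [vertexExponent, Finset.mem_map_equiv]

theorem VertexBound.reindex (e : κ ≃ ι) {C : ℝ}
    (h : VertexBound (fun y : κ → V => w (y ∘ e.symm)) C) : VertexBound w C := by
  intro s hs
  refine PowerBound.reindex e ?_
  rw [vertexExponent_comp]
  exact h _ (by simpa using hs)

end PowerBound

/-! ### Attaching a leaf to a weight -/

theorem sum_fin_succ_arrow {V M : Type*} [Fintype V] [AddCommMonoid M] {n : ℕ}
    (g : (Fin (n + 1) → V) → M) :
    ∑ x, g x = ∑ x : Fin n → V, ∑ y, g (Fin.snoc x y) := by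
  rw [Finset.sum_comm, ← Fintype.sum_prod_type']
  exact (Fintype.sum_equiv (Fin.snocEquiv fun _ => V) _ _ fun _ => rfl).symm

/-- The weight obtained by joining a new vertex to the vertex `v` with the kernel `k`. -/
def attachLeaf {V : Type*} {n : ℕ} (k : V → V → ℝ) (w : (Fin n → V) → ℝ) (v : Fin n)
    (x : Fin (n + 1) → V) : ℝ :=
  w (fun i => x i.castSucc) * k (x v.castSucc) (x (Fin.last n))

/-- Summing over the leaf leaves a function of the point at v. If it is dominated by c times a power
of one density χ, then χ takes the place of φ_v and the bound for the smaller weight applies; the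
exponents change only at v. -/
theorem PowerBound.attachLeaf {V : Type*} [Fintype V] {n : ℕ} {k : V → V → ℝ}
    {w : (Fin n → V) → ℝ} (hw : ∀ x, 0 ≤ w x) (v : Fin n) {a : Fin (n + 1) → ℝ} {a' : Fin n → ℝ}
    {C c : ℝ} (hc : 0 ≤ c) (ha : ∀ i, i ≠ v → a i.castSucc = a' i)
    (hχ : ∀ φ ψ : V → ℝ, IsDensity φ → IsDensity ψ → ∃ χ : V → ℝ, IsDensity χ ∧
      ∀ x, φ x ^ a v.castSucc * ∑ y, k x y * ψ y ^ a (Fin.last n) ≤ c * χ x ^ a' v)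
    (h : PowerBound w a' C) : PowerBound (attachLeaf k w v) a (c * C) := by
  intro φ hφ
  obtain ⟨χ, hχd, hχ⟩ := hχ _ _ (hφ v.castSucc) (hφ (Fin.last n))
  have h' := h (Function.update (fun i => φ i.castSucc) v χ) (by
    intro i
    rcases eq_or_ne i v with rfl | hi
    · simpa using hχd
    · simpa [hi] using hφ i.castSucc)
  rw [sum_fin_succ_arrow]
  refine le_trans ?_ (mul_le_mul_of_nonneg_left h' hc)
  rw [Finset.mul_sum]
  refine Finset.sum_le_sum fun x _ => ?_
  simp only [_root_.attachLeaf, Fin.prod_univ_castSucc, Fin.snoc_castSucc, Fin.snoc_last]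
  rw [← Finset.mul_prod_erase _ _ (Finset.mem_univ v)]
  rw [← Finset.mul_prod_erase (Finset.univ : Finset (Fin n)) (fun i => _ ^ a' i)
    (Finset.mem_univ v)]
  have hP : ∏ i ∈ Finset.univ.erase v,
      Function.update (fun i => φ (Fin.castSucc i)) v χ i (x i) ^ a' i =
      ∏ i ∈ Finset.univ.erase v, φ (Fin.castSucc i) (x i) ^ a i.castSucc := by
    refine Finset.prod_congr rfl fun i hi => ?_
    have hi := Finset.ne_of_mem_erase hi
    simp [hi, ha i hi]
  rw [hP, Function.update_self]
  set P := ∏ i ∈ Finset.univ.erase v, φ (Fin.castSucc i) (x i) ^ a i.castSucc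
  have hP0 : 0 ≤ P := Finset.prod_nonneg fun i _ => Real.rpow_nonneg ((hφ _).1 _) _
  calc _ = (w x * P) * (φ v.castSucc (x v) ^ a v.castSucc *
        ∑ y, k (x v) y * φ (Fin.last n) y ^ a (Fin.last n)) := by
        rw [← mul_assoc, Finset.mul_sum]
        refine Finset.sum_congr rfl fun y _ => ?_
        ring
    _ ≤ (w x * P) * (c * χ (x v) ^ a' v) :=
        mul_le_mul_of_nonneg_left (hχ _) (mul_nonneg (hw x) hP0)
    _ = _ := by ring

/-! ### Circle kernels and averages over circles -/

/-- The properties of the circle kernel in a plane with `q ^ 2` points that the bounds use: `K` is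
the adjacency matrix of a `D`-regular graph in which two distinct vertices have at most two
common neighbours. -/
structure IsCircleKernel {V : Type*} [Fintype V] (K : V → V → ℝ) (q D : ℝ) : Prop where
  zero_or_one : ∀ x y, K x y = 0 ∨ K x y = 1
  symm : ∀ x y, K x y = K y x
  irrefl : ∀ x, K x x = 0
  degree : ∀ x, ∑ y, K x y = D
  common : ∀ x y, x ≠ y → ∑ z, K x z * K y z ≤ 2
  card : (Fintype.card V : ℝ) = q ^ 2
  one_le : 1 ≤ q
  degree_le : D ≤ 2 * q
  le_degree : q ≤ 3 * D

namespace IsCircleKernel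

variable {V : Type*} [Fintype V] {K : V → V → ℝ} {q D : ℝ}

theorem nonneg (h : IsCircleKernel K q D) (x y : V) : 0 ≤ K x y := by
  rcases h.zero_or_one x y with h | h <;> simp [h]

theorem le_one (h : IsCircleKernel K q D) (x y : V) : K x y ≤ 1 := by
  rcases h.zero_or_one x y with h | h <;> simp [h]

theorem mul_self (h : IsCircleKernel K q D) (x y : V) : K x y * K x y = K x y := by
  rcases h.zero_or_one x y with h | h <;> simp [h]

theorem degree_pos (h : IsCircleKernel K q D) : 0 < D := by
  have := h.one_le
  have := h.le_degree
  linarith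

open Classical in
/-- The number of common neighbours, including the diagonal. -/
theorem common_le (h : IsCircleKernel K q D) (y z : V) :
    ∑ x, K x y * K x z ≤ (if y = z then D else 0) + 2 := by
  split_ifs with hyz
  · subst hyz
    rw [Finset.sum_congr rfl fun x _ => (h.mul_self x y).trans (h.symm x y), h.degree]
    linarith
  · rw [zero_add, Finset.sum_congr rfl fun x _ => by rw [h.symm x y, h.symm x z]]
    exact h.common y z hyz

-- The square of the smallest factor is at most the product of the other two, so it can be shared
-- between them. The three terms correspond to the choice of the smallest. If the other two points
-- coincide, the product is left alone, since the bound on common neighbours needs distinct points.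
omit [Fintype V] in
theorem triple_product_le {r : V → ℝ} (hr : ∀ x, 0 ≤ r x) [DecidableEq V] (y z w : V) :
    r y ^ 2 * r z ^ 2 * r w ^ 2 ≤
      (if y = z then r y ^ 4 * r w ^ 2 else r y ^ 3 * r z ^ 3) +
      (if z = w then r z ^ 4 * r y ^ 2 else r z ^ 3 * r w ^ 3) +
      (if w = y then r w ^ 4 * r z ^ 2 else r w ^ 3 * r y ^ 3) := by
  have nn : ∀ y z w : V, 0 ≤ (if y = z then r y ^ 4 * r w ^ 2 else r y ^ 3 * r z ^ 3) := by
    intro y z w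
    have := hr y
    have := hr z
    split_ifs <;> positivity
  have main : ∀ y z w : V, r w ≤ r y → r w ≤ r z → r y ^ 2 * r z ^ 2 * r w ^ 2 ≤
      (if y = z then r y ^ 4 * r w ^ 2 else r y ^ 3 * r z ^ 3) := by
    intro y z w h1 h2
    split_ifs with hyz
    · subst hyz
      exact le_of_eq (by ring)
    · have : r w ^ 2 ≤ r y * r z := by
        rw [sq]
        exact mul_le_mul h1 h2 (hr w) (hr y)
      calc _ ≤ r y ^ 2 * r z ^ 2 * (r y * r z) := by
            have := hr y
            have := hr z
            gcongr
        _ = _ := by ring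
  have n1 := nn y z w
  have n2 := nn z w y
  have n3 := nn w y z
  rcases le_total (r y) (r z) with h1 | h1 <;> rcases le_total (r z) (r w) with h2 | h2 <;>
    rcases le_total (r y) (r w) with h3 | h3
  · linarith [main z w y h1 h3]
  · linarith [main z w y h1 (h1.trans h2)]
  · linarith [main z w y h1 h3]
  · linarith [main y z w h3 h2]
  · linarith [main w y z h2 h1]
  · linarith [main w y z h2 h1]
  · linarith [main y z w (h2.trans h1) h2]
  · linarith [main y z w h3 h2]

/-- The hypothesis gives r³ ≤ q² and r ≤ q pointwise, which are pulled out of the higher moments;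
the second moment uses r² ≤ (2r³ + 1)/3. -/
theorem moments (h : IsCircleKernel K q D) {r : V → ℝ} (hr : ∀ x, 0 ≤ r x)
    (hsum : ∑ x, r x ^ 3 ≤ q ^ 2) :
    ∑ x, r x ^ 2 ≤ q ^ 2 ∧ ∑ x, r x ^ 4 ≤ q ^ 3 ∧ ∑ x, r x ^ 6 ≤ q ^ 4 := by
  have hq := h.one_le
  have h3 : ∀ x, r x ^ 3 ≤ q ^ 2 := fun x =>
    (Finset.single_le_sum (f := fun x => r x ^ 3) (fun i _ => pow_nonneg (hr i) 3)
      (Finset.mem_univ x)).trans hsum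
  have h1 : ∀ x, r x ≤ q := fun x => by
    refine le_of_pow_le_pow_left₀ three_ne_zero (by linarith) ((h3 x).trans ?_)
    exact pow_le_pow_right₀ hq (by norm_num)
  refine ⟨?_, ?_, ?_⟩
  · calc ∑ x, r x ^ 2 ≤ ∑ x, (2 / 3 * r x ^ 3 + 1 / 3) := by
          refine Finset.sum_le_sum fun x _ => ?_
          nlinarith [mul_nonneg (sq_nonneg (r x - 1)) (by linarith [hr x] : 0 ≤ 2 * r x + 1)]
      _ = 2 / 3 * ∑ x, r x ^ 3 + q ^ 2 * (1 / 3) := by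
          rw [Finset.sum_add_distrib, Finset.mul_sum]
          simp [h.card]
      _ ≤ q ^ 2 := by linarith
  · calc ∑ x, r x ^ 4 ≤ ∑ x, q * r x ^ 3 := by
          refine Finset.sum_le_sum fun x _ => ?_
          calc r x ^ 4 = r x * r x ^ 3 := by ring
            _ ≤ q * r x ^ 3 := mul_le_mul_of_nonneg_right (h1 x) (pow_nonneg (hr x) 3)
      _ = q * ∑ x, r x ^ 3 := by rw [Finset.mul_sum]
      _ ≤ q * q ^ 2 := mul_le_mul_of_nonneg_left hsum (by linarith)
      _ = q ^ 3 := by ring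
  · calc ∑ x, r x ^ 6 ≤ ∑ x, q ^ 2 * r x ^ 3 := by
          refine Finset.sum_le_sum fun x _ => ?_
          calc r x ^ 6 = r x ^ 3 * r x ^ 3 := by ring
            _ ≤ q ^ 2 * r x ^ 3 := mul_le_mul_of_nonneg_right (h3 x) (pow_nonneg (hr x) 3)
      _ = q ^ 2 * ∑ x, r x ^ 3 := by rw [Finset.mul_sum]
      _ ≤ q ^ 2 * q ^ 2 := mul_le_mul_of_nonneg_left hsum (by positivity)
      _ = q ^ 4 := by ring

/-- The circular averaging estimate `L^{3/2} → L^3`. -/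
theorem sum_cube_le (h : IsCircleKernel K q D) {r : V → ℝ} (hr : ∀ x, 0 ≤ r x)
    (hsum : ∑ x, r x ^ 3 ≤ q ^ 2) :
    ∑ x, (∑ y, K x y * r y ^ 2) ^ 3 ≤ 24 * q ^ 5 := by
  classical
  obtain ⟨m2, m4, m6⟩ := h.moments hr hsum
  have hq := h.one_le
  have hD := h.degree_pos
  have hD2 := h.degree_le
  -- The term for which w is the point with the smallest value; the other two terms of
  -- `triple_product_le` are its cyclic shifts and have the same sum.
  let T : V → V → V → ℝ := fun y z w =>
    if y = z then r y ^ 4 * r w ^ 2 else r y ^ 3 * r z ^ 3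
  have step1 : ∀ x, (∑ y, K x y * r y ^ 2) ^ 3 ≤
      3 * ∑ y, ∑ z, ∑ w, K x y * K x z * K x w * T y z w := by
    intro x
    have e1 : (∑ y, K x y * r y ^ 2) ^ 3 =
        ∑ y, ∑ z, ∑ w, K x y * K x z * K x w * (r y ^ 2 * r z ^ 2 * r w ^ 2) := by
      rw [pow_three, Finset.sum_mul_sum, Finset.sum_mul_sum]
      refine Finset.sum_congr rfl fun y _ => ?_
      refine Finset.sum_congr rfl fun z _ => ?_
      rw [Finset.mul_sum]
      refine Finset.sum_congr rfl fun w _ => ?_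
      ring
    have e2 : ∑ y, ∑ z, ∑ w, K x y * K x z * K x w * T z w y =
        ∑ y, ∑ z, ∑ w, K x y * K x z * K x w * T y z w := by
      rw [Finset.sum_comm]
      refine Finset.sum_congr rfl fun y _ => ?_
      rw [Finset.sum_comm]
      refine Finset.sum_congr rfl fun z _ => Finset.sum_congr rfl fun w _ => ?_
      ring
    have e3 : ∑ y, ∑ z, ∑ w, K x y * K x z * K x w * T w y z =
        ∑ y, ∑ z, ∑ w, K x y * K x z * K x w * T y z w := by
      rw [Finset.sum_congr rfl fun y _ => Finset.sum_comm, Finset.sum_comm]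
      refine Finset.sum_congr rfl fun y _ => ?_
      refine Finset.sum_congr rfl fun z _ => Finset.sum_congr rfl fun w _ => ?_
      ring
    calc _ = _ := e1
      _ ≤ ∑ y, ∑ z, ∑ w, (K x y * K x z * K x w * T y z w + K x y * K x z * K x w * T z w y +
            K x y * K x z * K x w * T w y z) := by
          refine Finset.sum_le_sum fun y _ => Finset.sum_le_sum fun z _ =>
            Finset.sum_le_sum fun w _ => ?_
          rw [← mul_add, ← mul_add]
          exact mul_le_mul_of_nonneg_left (triple_product_le hr y z w)
            (mul_nonneg (mul_nonneg (h.nonneg _ _) (h.nonneg _ _)) (h.nonneg _ _))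
      _ = _ := by
          simp only [Finset.sum_add_distrib]
          rw [e2, e3]
          ring
  have step2 : ∀ x, ∑ y, ∑ z, ∑ w, K x y * K x z * K x w * T y z w =
      (∑ y, ∑ w, K x y * K x w * (r y ^ 4 * r w ^ 2)) +
      ∑ y, ∑ z, if y = z then 0 else K x y * K x z * (D * (r y ^ 3 * r z ^ 3)) := by
    intro x
    rw [← Finset.sum_add_distrib]
    refine Finset.sum_congr rfl fun y _ => ?_
    have : ∀ z, ∑ w, K x y * K x z * K x w * T y z w =
        (if y = z then ∑ w, K x y * K x w * (r y ^ 4 * r w ^ 2) else 0) +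
        if y = z then 0 else K x y * K x z * (D * (r y ^ 3 * r z ^ 3)) := by
      intro z
      by_cases hyz : y = z
      · subst hyz
        simp only [T, if_true, add_zero]
        refine Finset.sum_congr rfl fun w _ => ?_
        rw [h.mul_self]
      · simp only [T, hyz, if_false, zero_add]
        rw [← h.degree x, Finset.sum_mul, Finset.mul_sum]
        refine Finset.sum_congr rfl fun w _ => ?_
        ring
    rw [Finset.sum_congr rfl fun z _ => this z, Finset.sum_add_distrib]
    simp
  -- The case y = z. Summing over x counts common neighbours of y and w, of which there are at most
  -- two unless y = w.
  have part1 : ∑ x, ∑ y, ∑ w, K x y * K x w * (r y ^ 4 * r w ^ 2) ≤ D * q ^ 4 + 2 * q ^ 5 := by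
    calc _ = ∑ y, ∑ w, (∑ x, K x y * K x w) * (r y ^ 4 * r w ^ 2) := by
          rw [Finset.sum_comm]
          refine Finset.sum_congr rfl fun y _ => ?_
          rw [Finset.sum_comm]
          refine Finset.sum_congr rfl fun w _ => ?_
          rw [Finset.sum_mul]
      _ ≤ ∑ y, ∑ w, ((if y = w then D else 0) + 2) * (r y ^ 4 * r w ^ 2) := by
          refine Finset.sum_le_sum fun y _ => Finset.sum_le_sum fun w _ => ?_
          exact mul_le_mul_of_nonneg_right (h.common_le y w) (by have := hr y; positivity)
      _ = D * ∑ y, r y ^ 6 + 2 * ((∑ y, r y ^ 4) * ∑ w, r w ^ 2) := by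
          rw [Finset.sum_mul_sum, Finset.mul_sum, Finset.mul_sum, ← Finset.sum_add_distrib]
          refine Finset.sum_congr rfl fun y _ => ?_
          simp only [add_mul, Finset.sum_add_distrib, ite_mul, zero_mul, Finset.sum_ite_eq,
            Finset.mem_univ, if_true, Finset.mul_sum]
          ring
      _ ≤ D * q ^ 4 + 2 * (q ^ 3 * q ^ 2) := by
          have : 0 ≤ ∑ w, r w ^ 2 := Finset.sum_nonneg fun w _ => sq_nonneg _
          gcongr
      _ = _ := by ring
  -- The case y ≠ z. The sum over w has produced the factor D, and at most two points x are adjacent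
  -- to both y and z.
  have part2 : ∑ x, ∑ y, ∑ z, (if y = z then 0 else K x y * K x z * (D * (r y ^ 3 * r z ^ 3))) ≤
      2 * D * q ^ 4 := by
    calc _ = ∑ y, ∑ z, ∑ x, (if y = z then 0 else K x y * K x z * (D * (r y ^ 3 * r z ^ 3))) := by
          rw [Finset.sum_comm]
          exact Finset.sum_congr rfl fun y _ => Finset.sum_comm
      _ ≤ ∑ y, ∑ z, 2 * (D * (r y ^ 3 * r z ^ 3)) := by
          refine Finset.sum_le_sum fun y _ => Finset.sum_le_sum fun z _ => ?_
          have hp : 0 ≤ D * (r y ^ 3 * r z ^ 3) := by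
            have := hr y
            have := hr z
            positivity
          by_cases hyz : y = z
          · simp only [hyz, if_true, Finset.sum_const_zero]
            rw [hyz] at hp
            linarith
          · simp only [hyz, if_false]
            rw [← Finset.sum_mul]
            refine mul_le_mul_of_nonneg_right ?_ hp
            simpa [hyz] using h.common_le y z
      _ = 2 * D * ((∑ y, r y ^ 3) * ∑ z, r z ^ 3) := by
          rw [Finset.sum_mul_sum, Finset.mul_sum]
          refine Finset.sum_congr rfl fun y _ => ?_
          rw [Finset.mul_sum]
          refine Finset.sum_congr rfl fun z _ => ?_
          ring
      _ ≤ 2 * D * (q ^ 2 * q ^ 2) := by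
          have : 0 ≤ ∑ w, r w ^ 3 := Finset.sum_nonneg fun w _ => pow_nonneg (hr w) 3
          gcongr
      _ = _ := by ring
  -- With D ≤ 2q the total 3(3Dq⁴ + 2q⁵) is at most 24q⁵.
  have hDq : D * q ^ 4 ≤ 2 * q ^ 5 := by
    calc D * q ^ 4 ≤ (2 * q) * q ^ 4 := mul_le_mul_of_nonneg_right hD2 (by positivity)
      _ = _ := by ring
  calc _ ≤ ∑ x, 3 * ∑ y, ∑ z, ∑ w, K x y * K x z * K x w * T y z w :=
        Finset.sum_le_sum fun x _ => step1 x
    _ = 3 * ((∑ x, ∑ y, ∑ w, K x y * K x w * (r y ^ 4 * r w ^ 2)) +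
      ∑ x, ∑ y, ∑ z, if y = z then 0 else K x y * K x z * (D * (r y ^ 3 * r z ^ 3))) := by
        rw [← Finset.mul_sum, Finset.sum_congr rfl fun x _ => step2 x, Finset.sum_add_distrib]
    _ ≤ 24 * q ^ 5 := by linarith

/-- The averaged kernel is stochastic. -/
theorem sum_div (h : IsCircleKernel K q D) (x : V) : ∑ y, K x y / D = 1 := by
  rw [← Finset.sum_div, h.degree, div_self h.degree_pos.ne']

theorem div_nonneg' (h : IsCircleKernel K q D) (x y : V) : 0 ≤ K x y / D :=
  div_nonneg (h.nonneg x y) h.degree_pos.le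

/-- Both ends of an edge in `L^{3/2}`. -/
theorem isDensity_edge (h : IsCircleKernel K q D) {φ ψ : V → ℝ} (hφ : IsDensity φ)
    (hψ : IsDensity ψ) : IsDensity fun x =>
      φ x ^ (2 / 3 : ℝ) * (∑ y, K x y / D * ψ y ^ (2 / 3 : ℝ)) / 217 := by
  have hq := h.one_le
  have hD := h.degree_pos
  have hψ' : ∀ y, 0 ≤ ψ y ^ (2 / 3 : ℝ) := fun y => Real.rpow_nonneg (hψ.1 y) _
  refine ⟨fun x => div_nonneg (mul_nonneg (Real.rpow_nonneg (hφ.1 x) _)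
    (Finset.sum_nonneg fun y _ => mul_nonneg (h.div_nonneg' x y) (hψ' y))) (by norm_num), ?_⟩
  have r3 : ∀ {a : ℝ}, 0 ≤ a → (a ^ (1 / 3 : ℝ)) ^ 3 = a := fun {a} ha => by
    rw [← Real.rpow_natCast, ← Real.rpow_mul ha]
    norm_num
  have r2 : ∀ {a : ℝ}, 0 ≤ a → a ^ (2 / 3 : ℝ) = (a ^ (1 / 3 : ℝ)) ^ 2 := fun {a} ha => by
    rw [← Real.rpow_natCast, ← Real.rpow_mul ha]
    norm_num
  have hcube := h.sum_cube_le (r := fun y => ψ y ^ (1 / 3 : ℝ))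
    (fun y => Real.rpow_nonneg (hψ.1 y) _) (by
      rw [Finset.sum_congr rfl fun y _ => r3 (hψ.1 y), ← h.card]
      exact hψ.2)
  -- Young's inequality s²u ≤ (2s³ + u³)/3 with s = φ^{1/3} and u the average of ψ^{2/3}. As q ≤ 3D,
  -- the cubes of u sum to at most 24 · 27 q² = 648q², and 2/3 + 648/3 < 217.
  have key : ∀ x, φ x ^ (2 / 3 : ℝ) * (∑ y, K x y / D * ψ y ^ (2 / 3 : ℝ)) ≤
      2 / 3 * φ x + 1 / 3 * ((∑ y, K x y * (ψ y ^ (1 / 3 : ℝ)) ^ 2) ^ 3 / D ^ 3) := by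
    intro x
    have e : (∑ y, K x y / D * ψ y ^ (2 / 3 : ℝ)) =
        (∑ y, K x y * (ψ y ^ (1 / 3 : ℝ)) ^ 2) / D := by
      rw [Finset.sum_div]
      refine Finset.sum_congr rfl fun y _ => ?_
      rw [r2 (hψ.1 y)]
      ring
    rw [e, ← div_pow, r2 (hφ.1 x)]
    set u := (∑ y, K x y * (ψ y ^ (1 / 3 : ℝ)) ^ 2) / D
    have hu : 0 ≤ u := div_nonneg (Finset.sum_nonneg fun y _ =>
      mul_nonneg (h.nonneg x y) (sq_nonneg _)) hD.le
    have hs : 0 ≤ φ x ^ (1 / 3 : ℝ) := Real.rpow_nonneg (hφ.1 x) _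
    have h3 := r3 (hφ.1 x)
    set s := φ x ^ (1 / 3 : ℝ)
    rw [← h3]
    nlinarith [mul_nonneg (sq_nonneg (s - u)) (by linarith : 0 ≤ 2 * s + u)]
  have hD3 : q ^ 3 ≤ 27 * D ^ 3 := by
    calc q ^ 3 ≤ (3 * D) ^ 3 := pow_le_pow_left₀ (by linarith) h.le_degree 3
      _ = _ := by ring
  rw [← Finset.sum_div, div_le_iff₀ (by norm_num), h.card]
  calc _ ≤ ∑ x, (2 / 3 * φ x +
        1 / 3 * ((∑ y, K x y * (ψ y ^ (1 / 3 : ℝ)) ^ 2) ^ 3 / D ^ 3)) :=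
        Finset.sum_le_sum fun x _ => key x
    _ = 2 / 3 * ∑ x, φ x +
        1 / 3 * ((∑ x, (∑ y, K x y * (ψ y ^ (1 / 3 : ℝ)) ^ 2) ^ 3) / D ^ 3) := by
        rw [Finset.sum_add_distrib, Finset.mul_sum, Finset.sum_div, Finset.mul_sum]
    _ ≤ 2 / 3 * q ^ 2 + 1 / 3 * (648 * q ^ 2) := by
        have hφ2 := hφ.2
        rw [h.card] at hφ2
        have : (∑ x, (∑ y, K x y * (ψ y ^ (1 / 3 : ℝ)) ^ 2) ^ 3) / D ^ 3 ≤ 648 * q ^ 2 := by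
          rw [div_le_iff₀ (by positivity)]
          refine hcube.trans ?_
          nlinarith [mul_le_mul_of_nonneg_left hD3 (by positivity : 0 ≤ 24 * q ^ 2)]
        linarith
    _ ≤ q ^ 2 * 217 := by nlinarith [sq_nonneg q]

/-- Averages of a density over circles form a density. -/
theorem isDensity_average (h : IsCircleKernel K q D) {ψ : V → ℝ} (hψ : IsDensity ψ) :
    IsDensity fun x => ∑ y, K x y / D * ψ y := by
  refine ⟨fun x => Finset.sum_nonneg fun y _ => mul_nonneg (h.div_nonneg' x y) (hψ.1 y), ?_⟩
  rw [Finset.sum_comm]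
  refine le_trans (le_of_eq (Finset.sum_congr rfl fun y _ => ?_)) hψ.2
  rw [← Finset.sum_mul, Finset.sum_congr rfl fun x _ => by rw [h.symm x y], h.sum_div, one_mul]

/-- Jensen's inequality for circular averages. -/
theorem average_rpow_le (h : IsCircleKernel K q D) {ψ : V → ℝ} (hψ : ∀ y, 0 ≤ ψ y) {a : ℝ}
    (ha : 0 < a) (ha1 : a ≤ 1) (x : V) :
    ∑ y, K x y / D * ψ y ^ a ≤ (∑ y, K x y / D * ψ y) ^ a := by
  have h1 := Real.rpow_arith_mean_le_arith_mean_rpow Finset.univ (fun y => K x y / D)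
    (fun y => ψ y ^ a) (fun y _ => h.div_nonneg' x y) (h.sum_div x)
    (fun y _ => Real.rpow_nonneg (hψ y) a) (p := 1 / a) (by rwa [le_div_iff₀ ha, one_mul])
  have h2 : ∀ y, (ψ y ^ a) ^ (1 / a) = ψ y := fun y => by
    rw [← Real.rpow_mul (hψ y), mul_one_div_cancel ha.ne', Real.rpow_one]
  simp only [h2] at h1
  have h0 : 0 ≤ ∑ y, K x y / D * ψ y ^ a :=
    Finset.sum_nonneg fun y _ => mul_nonneg (h.div_nonneg' x y) (Real.rpow_nonneg (hψ y) a)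
  have h3 := Real.rpow_le_rpow (Real.rpow_nonneg h0 _) h1 ha.le
  rwa [← Real.rpow_mul h0, one_div_mul_cancel ha.ne', Real.rpow_one] at h3

end IsCircleKernel

/-! ### Vertex bounds survive the attachment of a leaf -/

section AttachLeaf

variable {V : Type*} [Fintype V] {K : V → V → ℝ} {q D : ℝ} {n : ℕ}

/-- If the leaf is outside s, its kernel averages to one. If the leaf is in s but v is not, Jensen's
inequality hands the exponent of the leaf over to v. If both are in s, `isDensity_edge` fuses the
two densities into one at v, up to the factor 217. -/
theorem VertexBound.attachLeaf (h : IsCircleKernel K q D) {w : (Fin n → V) → ℝ}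
    (hw : ∀ x, 0 ≤ w x) {C : ℝ} (hv : VertexBound w C) (v : Fin n) :
    VertexBound (attachLeaf (fun x y => K x y / D) w v) (217 * C) := by
  classical
  intro s hs
  let s' : Finset (Fin n) := Finset.univ.filter fun i => i.castSucc ∈ s
  have hmem : ∀ i, i ∈ s' ↔ i.castSucc ∈ s := fun i => by simp [s']
  by_cases hl : Fin.last n ∈ s
  swap
  · have hcard : s'.card = s.card := by
      have : s = s'.map Fin.castSuccEmb := by
        ext i
        refine Fin.lastCases ?_ (fun j => ?_) i
        · simp [hl, Fin.castSucc_ne_last]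
        · simp [hmem]
      rw [this, Finset.card_map]
    refine PowerBound.attachLeaf hw v (by norm_num) (a' := vertexExponent s') (fun i _ => ?_) ?_
      (hv s' (by omega))
    · simp [vertexExponent, hmem, hcard]
    · intro φ ψ hφ _
      refine ⟨φ, hφ, fun x => ?_⟩
      have e1 : vertexExponent s (Fin.last n) = 0 := by simp [vertexExponent, hl]
      have e2 : vertexExponent s v.castSucc = vertexExponent s' v := by
        simp [vertexExponent, hmem, hcard]
      simp only [e1, e2, Real.rpow_zero, mul_one, h.sum_div]
      linarith [Real.rpow_nonneg (hφ.1 x) (vertexExponent s' v)]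
  have hcard : s.card = s'.card + 1 := by
    have : s = insert (Fin.last n) (s'.map Fin.castSuccEmb) := by
      ext i
      refine Fin.lastCases ?_ (fun j => ?_) i
      · simp [hl]
      · simp [hmem, Fin.castSucc_ne_last]
    rw [this, Finset.card_insert_of_notMem (by simp [Fin.castSucc_ne_last]), Finset.card_map]
  by_cases hvs : v ∈ s'
  swap
  · have hcard' : (insert v s').card = s.card := by
      rw [Finset.card_insert_of_notMem hvs, hcard]
    refine PowerBound.attachLeaf hw v (by norm_num) (a' := vertexExponent (insert v s'))
      (fun i hi => ?_) ?_ (hv _ (by omega))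
    · simp only [vertexExponent, Finset.mem_insert, hi, false_or, hmem, hcard']
    · intro φ ψ hφ hψ
      refine ⟨_, h.isDensity_average hψ, fun x => ?_⟩
      have e1 : vertexExponent s v.castSucc = 0 := by
        rw [hmem] at hvs
        simp [vertexExponent, hvs]
      have e2 : vertexExponent s (Fin.last n) = vertexExponent (insert v s') v := by
        simp [vertexExponent, hl, hcard']
      have e3 : vertexExponent (insert v s') v = 2 / ((s.card : ℝ) + 1) := by
        simp only [vertexExponent, Finset.mem_insert_self, if_true, hcard']
      have c1 : (1 : ℝ) ≤ s.card := by
        rw [hcard]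
        push_cast
        linarith [(s'.card.cast_nonneg : (0 : ℝ) ≤ s'.card)]
      rw [e1, e2, e3, Real.rpow_zero, one_mul]
      have hA := h.average_rpow_le hψ.1 (a := 2 / ((s.card : ℝ) + 1)) (by positivity)
        (by rw [div_le_one (by positivity)]; linarith) x
      have hn := Real.rpow_nonneg ((h.isDensity_average hψ).1 x) (2 / ((s.card : ℝ) + 1))
      simp only at hn
      linarith
  have e0 : vertexExponent s (Fin.last n) = 2 / ((s'.card : ℝ) + 2) := by
    simp only [vertexExponent, hl, if_true, hcard]
    push_cast
    ring
  have e1 : vertexExponent s v.castSucc = 2 / ((s'.card : ℝ) + 2) := by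
    rw [hmem] at hvs
    simp only [vertexExponent, hvs, if_true, hcard]
    push_cast
    ring
  have hpos : 0 < s'.card := Finset.card_pos.2 ⟨v, hvs⟩
  have hcases : s'.card = 1 ∨ s'.card = 2 := by omega
  rcases hcases with h1 | h2
  · refine PowerBound.attachLeaf hw v (by norm_num) (a' := vertexExponent s')
      (fun i hi => ?_) ?_ (hv _ (by omega))
    · have hi' : i ∉ s' := fun hi' => hi (Finset.card_le_one.1 h1.le i hi' v hvs)
      have hi'' := hi'
      rw [hmem] at hi''
      simp [vertexExponent, hi', hi'']
    · intro φ ψ hφ hψ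
      refine ⟨_, h.isDensity_edge hφ hψ, fun x => ?_⟩
      have e2 : vertexExponent s' v = 1 := by
        simp [vertexExponent, hvs, h1]
        norm_num
      have e3 : (2 : ℝ) / (((1 : ℕ) : ℝ) + 2) = 2 / 3 := by norm_num
      rw [e0, e1, e2, h1, e3, Real.rpow_one]
      exact le_of_eq (by ring)
  -- Three exponents 1/2, at the leaf, at v and at a third vertex. By Jensen φ^{1/2} A(ψ^{1/2}) ≤
  -- (φ^{2/3} A(ψ^{2/3}))^{3/4}, where A is the circular average, so exponents 3/4 at v and 1/2 at
  -- the third vertex remain. This is (3/4, 1/2) = 1/4 (1, 0) + 3/4 (2/3, 2/3), a convex combination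
  -- of two vertex exponents.
  · refine PowerBound.attachLeaf hw v (by norm_num)
      (a' := (1 / 4 : ℝ) • vertexExponent {v} + (3 / 4 : ℝ) • vertexExponent s')
      (fun i hi => ?_) ?_ ?_
    · by_cases hi' : i ∈ s'
      · have hi'' := hi'
        rw [hmem] at hi''
        simp [vertexExponent, hi', hi'', hi, h2, hcard]
        norm_num
      · have hi'' := hi'
        rw [hmem] at hi''
        simp [vertexExponent, hi', hi'', hi]
    · intro φ ψ hφ hψ
      refine ⟨_, h.isDensity_edge hφ hψ, fun x => ?_⟩
      have e2 : ((1 / 4 : ℝ) • vertexExponent {v} + (3 / 4 : ℝ) • vertexExponent s') v =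
          3 / 4 := by
        simp [vertexExponent, hvs, h2]
        norm_num
      have e3 : (2 : ℝ) / (((2 : ℕ) : ℝ) + 2) = 2 / 3 * (3 / 4) := by norm_num
      rw [e0, e1, e2, h2, e3, Real.rpow_mul (hφ.1 x)]
      simp only [fun y => Real.rpow_mul (hψ.1 y) (2 / 3) (3 / 4)]
      have hA := h.average_rpow_le (ψ := fun y => ψ y ^ (2 / 3 : ℝ))
        (fun y => Real.rpow_nonneg (hψ.1 y) _) (a := 3 / 4) (by norm_num) (by norm_num) x
      have hφ' : 0 ≤ φ x ^ (2 / 3 : ℝ) := Real.rpow_nonneg (hφ.1 x) _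
      have hψ' : 0 ≤ ∑ y, K x y / D * ψ y ^ (2 / 3 : ℝ) := Finset.sum_nonneg fun y _ =>
        mul_nonneg (h.div_nonneg' x y) (Real.rpow_nonneg (hψ.1 y) _)
      refine (mul_le_mul_of_nonneg_left hA (Real.rpow_nonneg hφ' _)).trans ?_
      rw [← Real.mul_rpow hφ' hψ', Real.div_rpow (mul_nonneg hφ' hψ') (by norm_num)]
      have h217 : (217 : ℝ) ^ (3 / 4 : ℝ) ≤ 217 :=
        Real.rpow_le_self_of_one_le (by norm_num) (by norm_num)
      rw [mul_div_assoc', le_div_iff₀ (by positivity), mul_comm]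
      exact mul_le_mul_of_nonneg_right h217 (Real.rpow_nonneg (mul_nonneg hφ' hψ') _)
    · refine (convex_powerBound hw C ⟨vertexExponent_nonneg _, hv {v} (by simp)⟩
        ⟨vertexExponent_nonneg _, hv s' (by omega)⟩ ?_ ?_ ?_).2 <;> norm_num

theorem attachLeaf_nonneg (h : IsCircleKernel K q D) {w : (Fin n → V) → ℝ}
    (hw : ∀ x, 0 ≤ w x) (v : Fin n) (x : Fin (n + 1) → V) :
    0 ≤ attachLeaf (fun x y => K x y / D) w v x :=
  mul_nonneg (hw _) (h.div_nonneg' _ _)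

theorem sum_attachLeaf (h : IsCircleKernel K q D) (w : (Fin n → V) → ℝ) (v : Fin n) :
    ∑ x, attachLeaf (fun x y => K x y / D) w v x = ∑ x, w x := by
  rw [sum_fin_succ_arrow]
  refine Finset.sum_congr rfl fun x _ => ?_
  simp only [attachLeaf, Fin.snoc_castSucc, Fin.snoc_last]
  rw [← Finset.mul_sum, h.sum_div, mul_one]

theorem sum_fin_one_arrow (g : (Fin 1 → V) → ℝ) : ∑ x, g x = ∑ y, g fun _ => y := by
  refine Fintype.sum_equiv (Equiv.funUnique (Fin 1) V) _ _ fun x => ?_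
  congr 1
  ext i
  simp [Subsingleton.elim i default]

/-- The single point from which the trees grow; exponent one is just the normalization of a density.
-/
theorem vertexBound_one (h : IsCircleKernel K q D) :
    VertexBound (fun _ : Fin 1 → V => (q ^ 2)⁻¹) 1 := by
  have hq : 0 < q ^ 2 := by
    have := h.one_le
    positivity
  intro s _ φ hφ
  rw [← Finset.mul_sum, sum_fin_one_arrow, inv_mul_le_iff₀ hq, mul_one, ← h.card]
  simp only [Finset.univ_unique, Finset.prod_singleton]
  by_cases h0 : (0 : Fin 1) ∈ s
  · have hs : s = {0} := by
      ext i
      simp [Subsingleton.elim i 0, h0]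
    simpa [vertexExponent, hs, ← two_mul, one_add_one_eq_two] using (hφ 0).2
  · simp [vertexExponent, h0]

end AttachLeaf

/-! ### The triangle form -/

/-- The square is a sum over pairs (y, z), (y', z'). AM-GM bounds the product of the four values
either by the crossed squares g(y)²h(z')² and g(y')²h(z)², whose free variables are then counted by
row and column sums of T, or by the straight squares g(y)²h(z)² and g(y')²h(z')². The crossed
version is avoided when y = z' or y' = z: later k(y)k(z) is summed over the third vertex of the
triangle, which is harmless only for distinct points. -/
theorem sq_sum_matrix_le {V : Type*} [Fintype V] [DecidableEq V] {T : V → V → ℝ} {k g h : V → ℝ}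
    (hT : ∀ y z, 0 ≤ T y z) (hk1 : ∀ y, k y ≤ 1)
    (hrow : ∀ y, ∑ z, T y z ≤ 2 * k y) (hcol : ∀ z, ∑ y, T y z ≤ 2 * k z) :
    (∑ y, ∑ z, T y z * (g y * h z)) ^ 2 ≤
      8 * (∑ y, ∑ z, if y = z then 0 else k y * k z * (g y ^ 2 * h z ^ 2)) +
      8 * ∑ y, ∑ z, T y z * (g y ^ 2 * h z ^ 2) := by
  let A : V → V → V → V → ℝ := fun y z y' z' => if y = z' then 0 else g y ^ 2 * h z' ^ 2
  let B : V → V → V → V → ℝ := fun y z y' z' => if y = z' then g y ^ 2 * h z ^ 2 else 0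
  let B' : V → V → V → V → ℝ := fun y z y' z' => if y = z' then g y' ^ 2 * h z' ^ 2 else 0
  have hk : ∀ y, 0 ≤ k y := fun y => by
    linarith [hrow y, Finset.sum_nonneg fun z (_ : z ∈ Finset.univ) => hT y z]
  have pt : ∀ y z y' z', (g y * h z) * (g y' * h z') ≤
      (A y z y' z' + B y z y' z' + B' y z y' z') +
      (A y' z' y z + B y' z' y z + B' y' z' y z) := by
    intro y z y' z'
    have n1 : 0 ≤ g y ^ 2 * h z ^ 2 := by positivity
    have n2 : 0 ≤ g y' ^ 2 * h z' ^ 2 := by positivity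
    have n3 : 0 ≤ g y ^ 2 * h z' ^ 2 := by positivity
    have n4 : 0 ≤ g y' ^ 2 * h z ^ 2 := by positivity
    have m1 := two_mul_le_add_sq (g y * h z) (g y' * h z')
    have m2 := two_mul_le_add_sq (g y * h z') (g y' * h z)
    simp only [A, B, B']
    split_ifs <;> nlinarith
  have hS : (∑ y, ∑ z, T y z * (g y * h z)) ^ 2 =
      ∑ y, ∑ z, ∑ y', ∑ z', T y z * T y' z' * ((g y * h z) * (g y' * h z')) := by
    rw [sq, Finset.sum_mul]
    refine Finset.sum_congr rfl fun y _ => ?_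
    rw [Finset.sum_mul]
    refine Finset.sum_congr rfl fun z _ => ?_
    rw [Finset.mul_sum]
    refine Finset.sum_congr rfl fun y' _ => ?_
    rw [Finset.mul_sum]
    refine Finset.sum_congr rfl fun z' _ => ?_
    ring
  have swap : ∀ E : V → V → V → V → ℝ,
      ∑ y, ∑ z, ∑ y', ∑ z', T y z * T y' z' * E y' z' y z =
      ∑ y, ∑ z, ∑ y', ∑ z', T y z * T y' z' * E y z y' z' := by
    intro E
    have comm4 : ∀ E' : V → V → V → V → ℝ, ∑ y, ∑ z, ∑ y', ∑ z', E' y z y' z' =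
        ∑ y', ∑ z', ∑ y, ∑ z, E' y z y' z' := by
      intro E'
      calc _ = ∑ y, ∑ y', ∑ z, ∑ z', E' y z y' z' :=
            Finset.sum_congr rfl fun y _ => Finset.sum_comm
        _ = ∑ y', ∑ y, ∑ z', ∑ z, E' y z y' z' := by
            rw [Finset.sum_comm]
            exact Finset.sum_congr rfl fun y' _ => Finset.sum_congr rfl fun y _ => Finset.sum_comm
        _ = _ := Finset.sum_congr rfl fun y' _ => Finset.sum_comm
    rw [comm4]
    refine Finset.sum_congr rfl fun y _ => Finset.sum_congr rfl fun z _ =>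
      Finset.sum_congr rfl fun y' _ => Finset.sum_congr rfl fun z' _ => ?_
    ring
  have hA : ∑ y, ∑ z, ∑ y', ∑ z', T y z * T y' z' * A y z y' z' ≤
      4 * ∑ y, ∑ z, if y = z then 0 else k y * k z * (g y ^ 2 * h z ^ 2) := by
    calc _ = ∑ y, ∑ z', (∑ z, T y z) * (∑ y', T y' z') *
          (if y = z' then 0 else g y ^ 2 * h z' ^ 2) := by
          refine Finset.sum_congr rfl fun y _ => ?_
          rw [Finset.sum_congr rfl fun z _ => Finset.sum_comm, Finset.sum_comm]
          refine Finset.sum_congr rfl fun z' _ => ?_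
          rw [Finset.sum_mul_sum, Finset.sum_mul]
          refine Finset.sum_congr rfl fun z _ => ?_
          rw [Finset.sum_mul]
      _ ≤ ∑ y, ∑ z', 4 * if y = z' then 0 else k y * k z' * (g y ^ 2 * h z' ^ 2) := by
          refine Finset.sum_le_sum fun y _ => Finset.sum_le_sum fun z' _ => ?_
          split_ifs
          · simp
          · have : (∑ z, T y z) * (∑ y', T y' z') ≤ (2 * k y) * (2 * k z') :=
              mul_le_mul (hrow y) (hcol z') (Finset.sum_nonneg fun _ _ => hT _ _)
                (by linarith [hk y])
            nlinarith [mul_le_mul_of_nonneg_right this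
              (by positivity : 0 ≤ g y ^ 2 * h z' ^ 2)]
      _ = _ := by simp only [Finset.mul_sum]
  have hB : ∑ y, ∑ z, ∑ y', ∑ z', T y z * T y' z' * B y z y' z' ≤
      2 * ∑ y, ∑ z, T y z * (g y ^ 2 * h z ^ 2) := by
    rw [Finset.mul_sum]
    refine Finset.sum_le_sum fun y _ => ?_
    rw [Finset.mul_sum]
    refine Finset.sum_le_sum fun z _ => ?_
    have : ∑ y', ∑ z', T y z * T y' z' * B y z y' z' =
        T y z * (g y ^ 2 * h z ^ 2) * ∑ y', T y' y := by
      rw [Finset.mul_sum]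
      refine Finset.sum_congr rfl fun y' _ => ?_
      simp only [B, mul_ite, mul_zero, Finset.sum_ite_eq, Finset.mem_univ, if_true]
      ring
    rw [this]
    have h2 : ∑ y', T y' y ≤ 2 := (hcol y).trans (by linarith [hk1 y])
    have h3 := mul_le_mul_of_nonneg_left h2
      (mul_nonneg (hT y z) (by positivity : 0 ≤ g y ^ 2 * h z ^ 2))
    linarith
  have hB' : ∑ y, ∑ z, ∑ y', ∑ z', T y z * T y' z' * B' y z y' z' ≤
      2 * ∑ y, ∑ z, T y z * (g y ^ 2 * h z ^ 2) := by
    rw [← swap, Finset.mul_sum]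
    refine Finset.sum_le_sum fun y _ => ?_
    rw [Finset.mul_sum]
    refine Finset.sum_le_sum fun z _ => ?_
    have : ∑ y', ∑ z', T y z * T y' z' * B' y' z' y z =
        T y z * (g y ^ 2 * h z ^ 2) * ∑ z', T z z' := by
      rw [Finset.mul_sum, Finset.sum_comm]
      refine Finset.sum_congr rfl fun y' _ => ?_
      simp only [B', mul_ite, mul_zero, Finset.sum_ite_eq', Finset.mem_univ, if_true]
      ring
    rw [this]
    have h2 : ∑ z', T z z' ≤ 2 := (hrow z).trans (by linarith [hk1 z])
    have h3 := mul_le_mul_of_nonneg_left h2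
      (mul_nonneg (hT y z) (by positivity : 0 ≤ g y ^ 2 * h z ^ 2))
    linarith
  calc _ = _ := hS
    _ ≤ ∑ y, ∑ z, ∑ y', ∑ z', (T y z * T y' z' * A y z y' z' + T y z * T y' z' * B y z y' z' +
          T y z * T y' z' * B' y z y' z' + T y z * T y' z' * A y' z' y z +
          T y z * T y' z' * B y' z' y z + T y z * T y' z' * B' y' z' y z) := by
        refine Finset.sum_le_sum fun y _ => Finset.sum_le_sum fun z _ =>
          Finset.sum_le_sum fun y' _ => Finset.sum_le_sum fun z' _ => ?_
        linarith [mul_le_mul_of_nonneg_left (pt y z y' z') (mul_nonneg (hT y z) (hT y' z'))]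
    _ ≤ _ := by
        simp only [Finset.sum_add_distrib]
        rw [swap A, swap B, swap B']
        linarith

namespace IsCircleKernel

variable {V : Type*} [Fintype V] {K : V → V → ℝ} {q D : ℝ}

theorem sum_triangle_le (h : IsCircleKernel K q D) (x y : V) :
    ∑ z, K x y * K y z * K x z ≤ 2 * K x y := by
  rcases eq_or_ne x y with rfl | hxy
  · simp [h.irrefl]
  · calc ∑ z, K x y * K y z * K x z = K x y * ∑ z, K x z * K y z := by
          rw [Finset.mul_sum]
          refine Finset.sum_congr rfl fun z _ => ?_
          ring
      _ ≤ K x y * 2 := mul_le_mul_of_nonneg_left (h.common x y hxy) (h.nonneg x y)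
      _ = _ := mul_comm _ _

theorem sum_triangle_le' (h : IsCircleKernel K q D) (x z : V) :
    ∑ y, K x y * K y z * K x z ≤ 2 * K x z := by
  refine le_trans (le_of_eq (Finset.sum_congr rfl fun y _ => ?_)) (h.sum_triangle_le x z)
  rw [h.symm z y]
  ring

theorem sum_triangle_le'' (h : IsCircleKernel K q D) (y z : V) :
    ∑ x, K x y * K y z * K x z ≤ 2 * K y z := by
  refine le_trans (le_of_eq (Finset.sum_congr rfl fun x _ => ?_)) (h.sum_triangle_le y z)
  rw [h.symm x y, h.symm x z]
  ring

/-- The triangle form with all three functions in `L^2`. -/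
theorem triangle_sq_le (h : IsCircleKernel K q D) {f g k : V → ℝ}
    (hf : ∑ x, f x ^ 2 ≤ q ^ 2) (hg : ∑ x, g x ^ 2 ≤ q ^ 2) (hk : ∑ x, k x ^ 2 ≤ q ^ 2) :
    ∑ x, ∑ y, ∑ z, K x y * K y z * K x z * (f x * (g y * k z)) ≤ 17 * q ^ 3 := by
  classical
  have hq := h.one_le
  have hT : ∀ x y z, 0 ≤ K x y * K y z * K x z := fun x y z =>
    mul_nonneg (mul_nonneg (h.nonneg _ _) (h.nonneg _ _)) (h.nonneg _ _)
  let u : V → ℝ := fun x => ∑ y, ∑ z, K x y * K y z * K x z * (g y * k z)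
  have hgk : (∑ y, g y ^ 2) * ∑ z, k z ^ 2 ≤ q ^ 4 := by
    calc _ ≤ q ^ 2 * q ^ 2 :=
          mul_le_mul hg hk (Finset.sum_nonneg fun _ _ => sq_nonneg _) (sq_nonneg _)
      _ = _ := by ring
  have hu : ∑ x, u x ^ 2 ≤ 32 * q ^ 4 := by
    have h1 : ∑ x, ∑ y, ∑ z, (if y = z then 0 else K x y * K x z * (g y ^ 2 * k z ^ 2)) ≤
        2 * q ^ 4 := by
      calc _ = ∑ y, ∑ z, ∑ x, (if y = z then 0 else K x y * K x z * (g y ^ 2 * k z ^ 2)) := by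
            rw [Finset.sum_comm]
            exact Finset.sum_congr rfl fun y _ => Finset.sum_comm
        _ ≤ ∑ y, ∑ z, 2 * (g y ^ 2 * k z ^ 2) := by
            refine Finset.sum_le_sum fun y _ => Finset.sum_le_sum fun z _ => ?_
            by_cases hyz : y = z
            · simp only [hyz, if_true, Finset.sum_const_zero]
              positivity
            · simp only [hyz, if_false]
              rw [← Finset.sum_mul]
              refine mul_le_mul_of_nonneg_right ?_ (by positivity)
              simpa [hyz] using h.common_le y z
        _ = 2 * ((∑ y, g y ^ 2) * ∑ z, k z ^ 2) := by
            rw [Finset.sum_mul_sum]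
            simp only [Finset.mul_sum]
        _ ≤ _ := by linarith
    have h2 : ∑ x, ∑ y, ∑ z, K x y * K y z * K x z * (g y ^ 2 * k z ^ 2) ≤ 2 * q ^ 4 := by
      calc _ = ∑ y, ∑ z, (∑ x, K x y * K y z * K x z) * (g y ^ 2 * k z ^ 2) := by
            rw [Finset.sum_comm]
            refine Finset.sum_congr rfl fun y _ => ?_
            rw [Finset.sum_comm]
            exact Finset.sum_congr rfl fun z _ => by rw [Finset.sum_mul]
        _ ≤ ∑ y, ∑ z, 2 * (g y ^ 2 * k z ^ 2) := by
            refine Finset.sum_le_sum fun y _ => Finset.sum_le_sum fun z _ => ?_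
            refine mul_le_mul_of_nonneg_right ((h.sum_triangle_le'' y z).trans ?_) (by positivity)
            linarith [h.le_one y z]
        _ = 2 * ((∑ y, g y ^ 2) * ∑ z, k z ^ 2) := by
            rw [Finset.sum_mul_sum]
            simp only [Finset.mul_sum]
        _ ≤ _ := by linarith
    calc _ ≤ ∑ x, (8 * (∑ y, ∑ z, if y = z then 0 else K x y * K x z * (g y ^ 2 * k z ^ 2)) +
          8 * ∑ y, ∑ z, K x y * K y z * K x z * (g y ^ 2 * k z ^ 2)) :=
          Finset.sum_le_sum fun x _ => sq_sum_matrix_le (hT x) (h.le_one x)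
            (h.sum_triangle_le x) (h.sum_triangle_le' x)
      _ ≤ _ := by
          rw [Finset.sum_add_distrib, ← Finset.mul_sum, ← Finset.mul_sum]
          linarith
  have h3 : ∑ x, ∑ y, ∑ z, K x y * K y z * K x z * (f x * (g y * k z)) = ∑ x, f x * u x := by
    refine Finset.sum_congr rfl fun x _ => ?_
    simp only [u, Finset.mul_sum]
    refine Finset.sum_congr rfl fun y _ => Finset.sum_congr rfl fun z _ => ?_
    ring
  -- The weights in q f u ≤ (q²f² + u²)/2 match the sizes ∑ f² ≤ q² and ∑ u² ≤ 32q⁴.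
  have h4 : q * ∑ x, f x * u x ≤ 17 * q ^ 4 := by
    calc q * ∑ x, f x * u x = ∑ x, q * (f x * u x) := by rw [Finset.mul_sum]
      _ ≤ ∑ x, (q ^ 2 / 2 * f x ^ 2 + 1 / 2 * u x ^ 2) := by
          refine Finset.sum_le_sum fun x _ => ?_
          nlinarith [sq_nonneg (q * f x - u x)]
      _ = q ^ 2 / 2 * (∑ x, f x ^ 2) + 1 / 2 * ∑ x, u x ^ 2 := by
          rw [Finset.sum_add_distrib, Finset.mul_sum, Finset.mul_sum]
      _ ≤ q ^ 2 / 2 * q ^ 2 + 1 / 2 * (32 * q ^ 4) := by gcongr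
      _ ≤ _ := by nlinarith [pow_pos (by linarith : 0 < q) 4]
  rw [h3]
  refine le_of_mul_le_mul_left (h4.trans (le_of_eq (by ring))) (by linarith : 0 < q)

end IsCircleKernel

theorem sum_fin_three_arrow {V : Type*} [Fintype V] (g : (Fin 3 → V) → ℝ) :
    ∑ x, g x = ∑ a, ∑ b, ∑ c, g ![a, b, c] := by
  rw [sum_fin_succ_arrow, sum_fin_succ_arrow, sum_fin_one_arrow]
  refine Finset.sum_congr rfl fun a _ => Finset.sum_congr rfl fun b _ =>
    Finset.sum_congr rfl fun c _ => ?_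
  congr 1
  ext i
  fin_cases i <;> rfl

/-- The product of the kernels over the edges of a triangle. -/
def triangleWeight {V : Type*} (K : V → V → ℝ) (x : Fin 3 → V) : ℝ :=
  K (x 0) (x 1) * K (x 1) (x 2) * K (x 0) (x 2)

/-- By this symmetry only the exponent sets ∅, {0}, {0, 1} and {0, 1, 2} need a bound. -/
theorem triangleWeight_comp {V : Type*} {K : V → V → ℝ} (hK : ∀ x y, K x y = K y x)
    (x : Fin 3 → V) (e : Equiv.Perm (Fin 3)) :
    triangleWeight K (x ∘ e) = triangleWeight K x := by
  have key : ∀ a b c : Fin 3, a ≠ b → b ≠ c → a ≠ c →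
      K (x a) (x b) * K (x b) (x c) * K (x a) (x c) =
        K (x 0) (x 1) * K (x 1) (x 2) * K (x 0) (x 2) := by
    intro a b c
    fin_cases a <;> fin_cases b <;> fin_cases c <;>
      simp only [Fin.zero_eta, Fin.mk_one, Fin.reduceFinMk, ne_eq, not_true_eq_false,
        IsEmpty.forall_iff, imp_true_iff,
        hK (x 1) (x 0), hK (x 2) (x 0), hK (x 2) (x 1)] <;> intros <;> ring
  exact key (e 0) (e 1) (e 2) (by simp) (by simp) (by simp)

/-- With at most two exponents present, the third vertex is summed out, with at most two positions
over each edge; this leaves a degree count or the edge estimate. All three exponents together are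
`triangle_sq_le`. The constant comes from the edge: 2 · 217 for the estimate, 2 from D ≤ 2q and 3
from q³ ≤ 3N. -/
theorem vertexBound_triangle {V : Type*} [Fintype V] {K : V → V → ℝ} {q D N : ℝ}
    (h : IsCircleKernel K q D) (hN : N = ∑ x, triangleWeight K x) (hNq : q ^ 3 ≤ 3 * N) :
    VertexBound (fun x => triangleWeight K x / N) 2604 := by
  have hq := h.one_le
  have hN0 : 0 < N := by
    have := pow_pos (by linarith : 0 < q) 3
    linarith
  intro s hs
  obtain ⟨e, he⟩ : ∃ e : Equiv.Perm (Fin 3), s.map e.symm.toEmbedding = ∅ ∨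
      s.map e.symm.toEmbedding = {0} ∨ s.map e.symm.toEmbedding = {0, 1} ∨
      s.map e.symm.toEmbedding = Finset.univ := by
    revert s
    decide
  refine PowerBound.reindex e ?_
  rw [vertexExponent_comp]
  simp only [triangleWeight_comp h.symm]
  intro φ hφ
  have hd : ∑ x : Fin 3 → V, triangleWeight K x / N *
      ∏ i, φ i (x i) ^ vertexExponent (s.map e.symm.toEmbedding) i =
      (∑ x : Fin 3 → V, triangleWeight K x *
      ∏ i, φ i (x i) ^ vertexExponent (s.map e.symm.toEmbedding) i) / N := by
    rw [Finset.sum_div]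
    refine Finset.sum_congr rfl fun x _ => ?_
    ring
  rw [hd, div_le_iff₀ hN0]
  rcases he with he | he | he | he <;> rw [he]
  · simp only [vertexExponent, Finset.notMem_empty, if_false, Real.rpow_zero,
      Finset.prod_const_one, mul_one]
    linarith
  · have hD := h.degree_le
    have h0 := (hφ 0).2
    rw [h.card] at h0
    have e1 : ∀ x : Fin 3 → V, ∏ i, φ i (x i) ^ vertexExponent {0} i = φ 0 (x 0) := by
      intro x
      rw [Fin.prod_univ_three]
      norm_num [vertexExponent]
      exact fun h => absurd h (by decide)
    simp only [e1]
    rw [sum_fin_three_arrow]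
    calc _ ≤ ∑ a, 2 * D * φ 0 a := by
          refine Finset.sum_le_sum fun a _ => ?_
          rw [← h.degree a, Finset.mul_sum, Finset.sum_mul]
          refine Finset.sum_le_sum fun b _ => ?_
          change ∑ c, K a b * K b c * K a c * φ 0 a ≤ _
          rw [← Finset.sum_mul]
          exact mul_le_mul_of_nonneg_right (h.sum_triangle_le a b) ((hφ 0).1 a)
      _ = 2 * D * ∑ a, φ 0 a := by rw [Finset.mul_sum]
      _ ≤ 2 * (2 * q) * q ^ 2 := by
          have := Finset.sum_nonneg fun a (_ : a ∈ Finset.univ) => (hφ 0).1 a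
          gcongr
      _ ≤ _ := by linarith
  · have hD := h.degree_le
    have hDpos := h.degree_pos
    have e1 : ∀ x : Fin 3 → V, ∏ i, φ i (x i) ^ vertexExponent {0, 1} i =
        φ 0 (x 0) ^ (2 / 3 : ℝ) * φ 1 (x 1) ^ (2 / 3 : ℝ) := by
      intro x
      rw [Fin.prod_univ_three]
      norm_num [vertexExponent]
      exact fun h => absurd h (by decide)
    simp only [e1]
    rw [sum_fin_three_arrow]
    have hE := (h.isDensity_edge (hφ 0) (hφ 1)).2
    rw [h.card] at hE
    calc _ ≤ ∑ a, 434 * D * (φ 0 a ^ (2 / 3 : ℝ) *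
          (∑ b, K a b / D * φ 1 b ^ (2 / 3 : ℝ)) / 217) := by
          refine Finset.sum_le_sum fun a _ => ?_
          have : 434 * D * (φ 0 a ^ (2 / 3 : ℝ) *
              (∑ b, K a b / D * φ 1 b ^ (2 / 3 : ℝ)) / 217) =
              ∑ b, 2 * K a b * (φ 0 a ^ (2 / 3 : ℝ) * φ 1 b ^ (2 / 3 : ℝ)) := by
            rw [Finset.mul_sum, Finset.sum_div, Finset.mul_sum]
            refine Finset.sum_congr rfl fun b _ => ?_
            field_simp
            ring
          rw [this]
          refine Finset.sum_le_sum fun b _ => ?_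
          change ∑ c, K a b * K b c * K a c *
            (φ 0 a ^ (2 / 3 : ℝ) * φ 1 b ^ (2 / 3 : ℝ)) ≤ _
          rw [← Finset.sum_mul]
          exact mul_le_mul_of_nonneg_right (h.sum_triangle_le a b)
            (mul_nonneg (Real.rpow_nonneg ((hφ 0).1 a) _) (Real.rpow_nonneg ((hφ 1).1 b) _))
      _ ≤ 434 * D * q ^ 2 := by
          rw [← Finset.mul_sum]
          exact mul_le_mul_of_nonneg_left hE (by positivity)
      _ ≤ 434 * (2 * q) * q ^ 2 := by gcongr
      _ ≤ 2604 * N := by nlinarith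
  · have e1 : ∀ x : Fin 3 → V, ∏ i, φ i (x i) ^ vertexExponent Finset.univ i =
        φ 0 (x 0) ^ (1 / 2 : ℝ) * (φ 1 (x 1) ^ (1 / 2 : ℝ) * φ 2 (x 2) ^ (1 / 2 : ℝ)) := by
      intro x
      rw [Fin.prod_univ_three]
      norm_num [vertexExponent]
      ring
    simp only [e1]
    rw [sum_fin_three_arrow]
    have h2 : ∀ i, ∑ x, (φ i x ^ (1 / 2 : ℝ)) ^ 2 ≤ q ^ 2 := by
      intro i
      rw [← h.card]
      refine le_trans (le_of_eq (Finset.sum_congr rfl fun x _ => ?_)) (hφ i).2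
      rw [← Real.rpow_natCast, ← Real.rpow_mul ((hφ i).1 x)]
      norm_num
    refine (h.triangle_sq_le (h2 0) (h2 1) (h2 2)).trans ?_
    linarith

/-! ### Circles over a finite field -/

section Circle

variable {F : Type} [Field F] [Fintype F] {t : F}

omit [Fintype F] in
theorem sqNorm_two (x : Fin 2 → F) : sqNorm x = x 0 ^ 2 + x 1 ^ 2 := by
  simp [sqNorm, Fin.sum_univ_two]

omit [Fintype F] in
theorem sqNorm_sub_comm {d : ℕ} (x y : Fin d → F) : sqNorm (x - y) = sqNorm (y - x) := by
  unfold sqNorm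
  refine Finset.sum_congr rfl fun i _ => ?_
  simp only [Pi.sub_apply]
  ring

omit [Fintype F] in
theorem card_le_two_of_sq_eq {α : Type*} (s : Finset α) (f : α → F) (c : F)
    (hf : Set.InjOn f s) (hc : ∀ x ∈ s, f x ^ 2 = c) : s.card ≤ 2 := by
  classical
  rw [← Finset.card_image_of_injOn hf]
  have : s.image f ⊆ (Polynomial.nthRoots 2 c).toFinset := by
    intro y hy
    obtain ⟨x, hx, rfl⟩ := Finset.mem_image.1 hy
    rw [Multiset.mem_toFinset, Polynomial.mem_nthRoots (by norm_num)]
    exact hc x hx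
  exact (Finset.card_le_card this).trans ((Multiset.toFinset_card_le _).trans
    (Polynomial.card_nthRoots 2 c))

omit [Fintype F] in
theorem two_ne_zero_of_ringChar (hF : ringChar F ≠ 2) : (2 : F) ≠ 0 :=
  Ring.two_ne_zero hF

-- Let (a, b) = y - x. For a common neighbour z, subtracting the two circle equations fixes the dot
-- product of z - x with (a, b), and Lagrange's identity then fixes the square of the cross product.
-- If a² + b² ≠ 0, these two products determine z. If a² + b² = 0, both vanish, which forces t(a, b)
-- = 0, so there is no common neighbour.
open Classical in
theorem card_common_neighbours_le (hF : ringChar F ≠ 2) (ht : t ≠ 0) {x y : Fin 2 → F}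
    (hxy : x ≠ y) :
    (Finset.univ.filter fun z : Fin 2 → F => sqNorm (x - z) = t ∧ sqNorm (y - z) = t).card ≤ 2 := by
  have h2 := two_ne_zero_of_ringChar hF
  set a := y 0 - x 0 with ha
  set b := y 1 - x 1 with hb
  have hab : a ≠ 0 ∨ b ≠ 0 := by
    by_contra! hcon
    refine hxy ?_
    ext i
    fin_cases i
    · exact (sub_eq_zero.1 hcon.1).symm
    · exact (sub_eq_zero.1 hcon.2).symm
  have dot : ∀ z : Fin 2 → F, sqNorm (x - z) = t → sqNorm (y - z) = t →
      2 * ((z 0 - x 0) * a + (z 1 - x 1) * b) = a ^ 2 + b ^ 2 := by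
    intro z hz1 hz2
    rw [sqNorm_two] at hz1 hz2
    simp only [Pi.sub_apply] at hz1 hz2
    rw [ha, hb]
    linear_combination hz1 - hz2
  have cross : ∀ z : Fin 2 → F, sqNorm (x - z) = t → sqNorm (y - z) = t →
      4 * ((z 0 - x 0) * b - (z 1 - x 1) * a) ^ 2 =
        4 * t * (a ^ 2 + b ^ 2) - (a ^ 2 + b ^ 2) ^ 2 := by
    intro z hz1 hz2
    have h := dot z hz1 hz2
    rw [sqNorm_two] at hz1
    simp only [Pi.sub_apply] at hz1
    rw [← hz1]
    linear_combination (-1) * h * (2 * ((z 0 - x 0) * a + (z 1 - x 1) * b) + a ^ 2 + b ^ 2)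
  have hne : ∀ z : Fin 2 → F, sqNorm (x - z) = t → sqNorm (y - z) = t → a ^ 2 + b ^ 2 ≠ 0 := by
    intro z hz1 hz2 h0
    have h1 := dot z hz1 hz2
    have h3 := cross z hz1 hz2
    rw [h0] at h1 h3
    have h1' : (z 0 - x 0) * a + (z 1 - x 1) * b = 0 := by
      simpa [h2] using h1
    have h4 : (4 : F) ≠ 0 := by
      rw [show (4 : F) = 2 * 2 by norm_num]
      exact mul_ne_zero h2 h2
    have h3' : (z 0 - x 0) * b - (z 1 - x 1) * a = 0 := by
      simpa [h4] using h3
    rw [sqNorm_two] at hz1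
    simp only [Pi.sub_apply] at hz1
    have e1 : t * a = 0 := by
      rw [← hz1]
      linear_combination (z 0 - x 0) * h1' - (z 1 - x 1) * h3'
    have e2 : t * b = 0 := by
      rw [← hz1]
      linear_combination (z 1 - x 1) * h1' + (z 0 - x 0) * h3'
    rcases hab with h | h
    · exact (mul_ne_zero ht h) e1
    · exact (mul_ne_zero ht h) e2
  refine card_le_two_of_sq_eq _ (fun z => 2 * ((z 0 - x 0) * b - (z 1 - x 1) * a))
    (4 * t * (a ^ 2 + b ^ 2) - (a ^ 2 + b ^ 2) ^ 2) ?_ ?_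
  · intro z hz z' hz' heq
    simp only [Finset.coe_filter, Finset.mem_univ, true_and, Set.mem_ofPred_eq] at hz hz'
    have n0 := hne z hz.1 hz.2
    have d1 := dot z hz.1 hz.2
    have d2 := dot z' hz'.1 hz'.2
    simp only at heq
    have e0 : 2 * (a ^ 2 + b ^ 2) * (z 0 - z' 0) = 0 := by
      linear_combination a * d1 - a * d2 + b * heq
    have e1 : 2 * (a ^ 2 + b ^ 2) * (z 1 - z' 1) = 0 := by
      linear_combination b * d1 - b * d2 - a * heq
    have n1 := mul_ne_zero h2 n0
    ext i
    fin_cases i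
    · exact sub_eq_zero.1 ((mul_eq_zero.1 e0).resolve_left n1)
    · exact sub_eq_zero.1 ((mul_eq_zero.1 e1).resolve_left n1)
  · intro z hz
    simp only [Finset.mem_filter, Finset.mem_univ, true_and] at hz
    rw [← cross z hz.1 hz.2]
    ring

open Classical in
theorem card_circle_le :
    (Finset.univ.filter fun y : Fin 2 → F => sqNorm y = t).card ≤ 2 * Fintype.card F := by
  rw [← Finset.card_univ (α := F)]
  refine Finset.card_le_mul_card_image_of_maps_to (f := fun y => y 0) (fun _ _ => Finset.mem_univ _)
    2 fun b _ => ?_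
  refine card_le_two_of_sq_eq _ (fun y => y 1) (t - b ^ 2) ?_ ?_
  · intro y hy z hz hyz
    simp only [Finset.coe_filter, Finset.mem_filter, Finset.mem_univ, true_and,
      Set.mem_ofPred_eq] at hy hz
    ext i
    fin_cases i
    · exact hy.2.trans hz.2.symm
    · exact hyz
  · intro y hy
    simp only [Finset.mem_filter, Finset.mem_univ, true_and] at hy
    rw [← hy.1, ← hy.2, sqNorm_two]
    ring

theorem exists_sqNorm_eq (hF : ringChar F ≠ 2) (t : F) : ∃ y : Fin 2 → F, sqNorm y = t := by
  obtain ⟨a, b, hab⟩ := FiniteField.exists_root_sum_quadratic (R := F)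
    (f := Polynomial.X ^ 2) (g := Polynomial.X ^ 2 - Polynomial.C t) (Polynomial.degree_X_pow 2)
    (Polynomial.degree_X_pow_sub_C (by decide) t) (FiniteField.odd_card_of_char_ne_two hF)
  refine ⟨![a, b], ?_⟩
  rw [sqNorm_two]
  simp only [Polynomial.eval_pow, Polynomial.eval_X, Polynomial.eval_sub, Polynomial.eval_C] at hab
  simp only [Matrix.cons_val_zero, Matrix.cons_val_one]
  linear_combination hab

-- The line of slope m through a point p of the circle meets it in a second point unless it is
-- isotropic (m² = -1, at most two slopes) or tangent (at most one). With p itself this gives at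
-- least q - 2 points, and q ≤ 3(q - 2) because q ≥ 3.
open Classical in
theorem card_le_card_circle (hF : ringChar F ≠ 2) (ht : t ≠ 0) :
    Fintype.card F ≤ 3 * (Finset.univ.filter fun y : Fin 2 → F => sqNorm y = t).card := by
  have h2 := two_ne_zero_of_ringChar hF
  obtain ⟨p, hp⟩ := exists_sqNorm_eq hF t
  rw [sqNorm_two] at hp
  set S := Finset.univ.filter fun y : Fin 2 → F => sqNorm y = t with hS
  let M : Finset F := Finset.univ.filter fun m => 1 + m ^ 2 ≠ 0 ∧ p 0 + p 1 * m ≠ 0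
  let c : F → F := fun m => -2 * (p 0 + p 1 * m) / (1 + m ^ 2)
  let P : F → Fin 2 → F := fun m => ![p 0 + c m, p 1 + c m * m]
  have hc : ∀ m ∈ M, c m ≠ 0 := by
    intro m hm
    simp only [M, Finset.mem_filter, Finset.mem_univ, true_and] at hm
    exact div_ne_zero (mul_ne_zero (neg_ne_zero.2 h2) hm.2) hm.1
  have hMS : (M.image P).card + 1 ≤ S.card := by
    have hp' : p ∉ M.image P := by
      intro h
      obtain ⟨m, hm, hPm⟩ := Finset.mem_image.1 h
      refine hc m hm ?_
      have := congrFun hPm 0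
      simpa [P] using this
    rw [← Finset.card_insert_of_notMem hp']
    refine Finset.card_le_card fun y hy => ?_
    simp only [hS, Finset.mem_filter, Finset.mem_univ, true_and]
    rcases Finset.mem_insert.1 hy with rfl | hy
    · rw [sqNorm_two, hp]
    · obtain ⟨m, hm, rfl⟩ := Finset.mem_image.1 hy
      simp only [M, Finset.mem_filter, Finset.mem_univ, true_and] at hm
      rw [sqNorm_two]
      simp only [P, Matrix.cons_val_zero, Matrix.cons_val_one]
      have hcm : c m * (1 + m ^ 2) = -2 * (p 0 + p 1 * m) := div_mul_cancel₀ _ hm.1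
      linear_combination hp + c m * hcm
  have hinj : (M.image P).card = M.card := by
    refine Finset.card_image_of_injOn fun m hm m' hm' h => ?_
    have e0 := congrFun h 0
    have e1 := congrFun h 1
    simp only [P, Matrix.cons_val_zero, Matrix.cons_val_one, add_right_inj] at e0 e1
    rw [← e0] at e1
    exact mul_left_cancel₀ (hc m hm) e1
  have hcompl : Fintype.card F ≤ M.card + 3 := by
    have hsub : (Finset.univ : Finset F) ⊆ M ∪ ((Finset.univ.filter fun m : F => m ^ 2 = -1) ∪
        Finset.univ.filter fun m : F => p 0 + p 1 * m = 0) := by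
      intro m _
      simp only [M, Finset.mem_union, Finset.mem_filter, Finset.mem_univ, true_and]
      by_cases h1 : m ^ 2 = -1
      · exact Or.inr (Or.inl h1)
      · by_cases h3 : p 0 + p 1 * m = 0
        · exact Or.inr (Or.inr h3)
        · exact Or.inl ⟨fun h => h1 (by linear_combination h), h3⟩
    have c1 : (Finset.univ.filter fun m : F => m ^ 2 = -1).card ≤ 2 :=
      card_le_two_of_sq_eq _ id (-1) Function.injective_id.injOn fun m hm => by simpa using hm
    have c2 : (Finset.univ.filter fun m : F => p 0 + p 1 * m = 0).card ≤ 1 := by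
      refine Finset.card_le_one.2 fun m hm m' hm' => ?_
      simp only [Finset.mem_filter, Finset.mem_univ, true_and] at hm hm'
      have hp1 : p 1 ≠ 0 := by
        intro h
        rw [h] at hm hp
        have : p 0 = 0 := by simpa using hm
        rw [this] at hp
        exact ht (by simpa using hp.symm)
      have : p 1 * m = p 1 * m' := by linear_combination hm - hm'
      exact mul_left_cancel₀ hp1 this
    calc Fintype.card F = (Finset.univ : Finset F).card := rfl
      _ ≤ _ := Finset.card_le_card hsub
      _ ≤ M.card + (2 + 1) := (Finset.card_union_le _ _).trans
          (Nat.add_le_add_left ((Finset.card_union_le _ _).trans (Nat.add_le_add c1 c2)) _)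
  have h3 : 3 ≤ Fintype.card F := by
    have h1 := Fintype.one_lt_card (α := F)
    have h4 := FiniteField.odd_card_of_char_ne_two hF
    omega
  omega

omit [Fintype F] in
theorem sphereKernel_zero_or_one {d : ℕ} (t : F) (x y : Fin d → F) :
    sphereKernel t x y = 0 ∨ sphereKernel t x y = 1 := by
  unfold sphereKernel
  split_ifs <;> simp

open Classical in
theorem isCircleKernel_sphereKernel (hF : ringChar F ≠ 2) (ht : t ≠ 0) :
    IsCircleKernel (sphereKernel (d := 2) t) (Fintype.card F)
      (Finset.univ.filter fun y : Fin 2 → F => sqNorm y = t).card where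
  zero_or_one := sphereKernel_zero_or_one t
  symm x y := by
    unfold sphereKernel
    rw [sqNorm_sub_comm]
  irrefl x := by
    unfold sphereKernel
    rw [if_neg]
    simp [sqNorm_two, ht.symm]
  degree x := by
    rw [← Finset.sum_boole]
    refine Fintype.sum_equiv (Equiv.subRight x) _ _ fun y => ?_
    simp only [sphereKernel, Equiv.subRight_apply]
    rw [sqNorm_sub_comm]
  common x y hxy := by
    have : ∀ z, sphereKernel t x z * sphereKernel t y z =
        if sqNorm (x - z) = t ∧ sqNorm (y - z) = t then 1 else 0 := by
      intro z
      simp only [sphereKernel, ite_and, mul_ite, mul_one, mul_zero]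
      split_ifs <;> rfl
    rw [Finset.sum_congr rfl fun z _ => this z, Finset.sum_boole]
    exact_mod_cast card_common_neighbours_le hF ht hxy
  card := by simp
  one_le := by exact_mod_cast Fintype.card_pos
  degree_le := by exact_mod_cast card_circle_le
  le_degree := by exact_mod_cast card_le_card_circle hF ht

/-- Here 3 must be a square: the midpoint of an edge plus √3/2 times the rotated edge completes an
equilateral triangle. So there are at least as many triangles as ordered edges, namely q²D ≥ q³/3.
-/
theorem card_cube_le_sum_triangleWeight (hF : ringChar F ≠ 2) (h3 : IsSquare (3 : F))
    (ht : t ≠ 0) :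
    (Fintype.card F : ℝ) ^ 3 ≤ 3 * ∑ x, triangleWeight (sphereKernel (d := 2) t) x := by
  classical
  have h := isCircleKernel_sphereKernel hF ht
  have h2 := two_ne_zero_of_ringChar hF
  obtain ⟨r, hr⟩ := h3
  have hz : ∀ x y : Fin 2 → F, sphereKernel t x y ≤
      ∑ z, sphereKernel t x y * sphereKernel t y z * sphereKernel t x z := by
    intro x y
    by_cases hxy : sqNorm (x - y) = t
    swap
    · have h0 : sphereKernel t x y = 0 := if_neg hxy
      simp [h0]
    let z : Fin 2 → F := ![x 0 + (y 0 - x 0) / 2 - r / 2 * (y 1 - x 1),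
      x 1 + (y 1 - x 1) / 2 + r / 2 * (y 0 - x 0)]
    have hxz : sqNorm (x - z) = t := by
      rw [sqNorm_two] at hxy ⊢
      rw [← hxy]
      simp only [z, Pi.sub_apply, Matrix.cons_val_zero, Matrix.cons_val_one]
      field_simp
      linear_combination (-1) * ((y 1 - x 1) ^ 2 + (y 0 - x 0) ^ 2) * hr
    have hyz : sqNorm (y - z) = t := by
      rw [sqNorm_two] at hxy ⊢
      rw [← hxy]
      simp only [z, Pi.sub_apply, Matrix.cons_val_zero, Matrix.cons_val_one]
      field_simp
      linear_combination (-1) * ((y 1 - x 1) ^ 2 + (y 0 - x 0) ^ 2) * hr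
    refine le_trans (le_of_eq ?_) (Finset.single_le_sum (fun z _ => ?_) (Finset.mem_univ z))
    · simp [sphereKernel, hxz, hyz, hxy]
    · exact mul_nonneg (mul_nonneg (h.nonneg _ _) (h.nonneg _ _)) (h.nonneg _ _)
  rw [sum_fin_three_arrow]
  have h1 := h.le_degree
  set D : ℝ := ((Finset.univ.filter fun y : Fin 2 → F => sqNorm y = t).card : ℝ)
  have hs : (Fintype.card F : ℝ) ^ 2 * D ≤
      ∑ a, ∑ b, ∑ c, triangleWeight (sphereKernel (d := 2) t) ![a, b, c] := by
    rw [← h.card, ← nsmul_eq_mul, ← Finset.card_univ, ← Finset.sum_const]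
    refine Finset.sum_le_sum fun x _ => ?_
    rw [← h.degree x]
    exact Finset.sum_le_sum fun y _ => hz x y
  nlinarith [mul_le_mul_of_nonneg_left h1 (sq_nonneg (Fintype.card F : ℝ))]

end Circle

/-! ### Graph forms as sums against a probability weight -/

section GraphWeight

variable {F : Type} [Field F] [Fintype F] {d n m : ℕ}

open Classical in
/-- The indicator function of the placements of the vertices of `G`. -/
noncomputable def placementIndicator (t : F) (G : SimpleGraph (Fin n)) (x : Fin n → Fin d → F) :
    ℝ :=
  if ∀ i j, G.Adj i j → sqNorm (x i - x j) = t then 1 else 0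

/-- The normalized indicator function of the placements of the vertices of `G`. -/
noncomputable def graphWeight (t : F) (G : SimpleGraph (Fin n)) (x : Fin n → Fin d → F) : ℝ :=
  placementIndicator t G x / numPlacements d t G

omit [Fintype F] in
theorem placementIndicator_nonneg (t : F) (G : SimpleGraph (Fin n)) (x : Fin n → Fin d → F) :
    0 ≤ placementIndicator t G x := by
  unfold placementIndicator
  split_ifs <;> norm_num

omit [Fintype F] in
theorem graphWeight_nonneg (t : F) (G : SimpleGraph (Fin n)) (x : Fin n → Fin d → F) :
    0 ≤ graphWeight t G x :=
  div_nonneg (placementIndicator_nonneg t G x) (Nat.cast_nonneg _)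

theorem numPlacements_eq_sum (t : F) (G : SimpleGraph (Fin n)) :
    (numPlacements d t G : ℝ) = ∑ x : Fin n → Fin d → F, placementIndicator t G x := by
  classical
  unfold placementIndicator numPlacements
  rw [Finset.sum_boole, Nat.card_eq_fintype_card, Fintype.card_subtype]

theorem graphForm_eq_sum (t : F) (G : SimpleGraph (Fin n)) (f : Fin n → (Fin d → F) → ℝ) :
    graphForm t G f = ∑ x : Fin n → Fin d → F, graphWeight t G x * ∏ l, f l (x l) := by
  classical
  unfold graphForm
  rw [Finset.mul_sum]
  refine Finset.sum_congr rfl fun x _ => ?_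
  rw [graphWeight, div_eq_inv_mul, mul_assoc]
  congr 2
  unfold placementIndicator
  split_ifs with h
  · refine Finset.prod_eq_one fun e he => ?_
    exact if_pos (h _ _ (Finset.mem_filter.1 he).2.2)
  · push Not at h
    obtain ⟨i, j, hij, hne⟩ := h
    rcases lt_or_gt_of_ne hij.ne with hlt | hlt
    · exact Finset.prod_eq_zero (i := (i, j)) (Finset.mem_filter.2 ⟨Finset.mem_univ _, hlt, hij⟩)
        (if_neg hne)
    · refine Finset.prod_eq_zero (i := (j, i))
        (Finset.mem_filter.2 ⟨Finset.mem_univ _, hlt, hij.symm⟩) (if_neg ?_)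
      rwa [sqNorm_sub_comm]

/-- Total mass one determines the normalization, so 𝒩(G) need not be computed for the weights built
by attaching leaves. The permutation absorbs the order of attachment. -/
theorem eq_graphWeight_comp {t : F} {G : SimpleGraph (Fin n)} (e : Equiv.Perm (Fin n))
    {w : (Fin n → Fin d → F) → ℝ} (hw : ∑ x, w x = 1) {c : ℝ}
    (hc : ∀ x, w x = c * placementIndicator t G (x ∘ e)) :
    w = fun x => graphWeight t G (x ∘ e) := by
  have hN : c * numPlacements d t G = 1 := by
    rw [← hw, numPlacements_eq_sum, Finset.mul_sum]
    refine (Fintype.sum_equiv (e.symm.arrowCongr (Equiv.refl _)) _ _ fun x => ?_).symm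
    rw [hc]
    congr 2
  have hc' : c = 1 / numPlacements d t G :=
    eq_one_div_of_mul_eq_one_left hN
  ext x
  rw [hc, hc', graphWeight]
  ring

theorem graphWeight_iso (t : F) {G : SimpleGraph (Fin n)} {G₀ : SimpleGraph (Fin m)}
    (e : G₀ ≃g G) (y : Fin m → Fin d → F) :
    graphWeight t G (y ∘ e.toEquiv.symm) = graphWeight t G₀ y := by
  have h1 : ∀ y : Fin m → Fin d → F,
      placementIndicator t G (y ∘ e.toEquiv.symm) = placementIndicator t G₀ y := by
    intro y
    unfold placementIndicator
    congr 1
    refine propext ⟨fun h i j hij => ?_, fun h i j hij => ?_⟩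
    · have := h (e i) (e j) (e.map_rel_iff.2 hij)
      rwa [Function.comp_apply, Function.comp_apply, show e.toEquiv.symm (e i) = i from
        e.symm_apply_apply i, show e.toEquiv.symm (e j) = j from e.symm_apply_apply j] at this
    · exact h _ _ (e.symm.map_rel_iff.2 hij)
  have h2 : (numPlacements d t G : ℝ) = numPlacements d t G₀ := by
    rw [numPlacements_eq_sum, numPlacements_eq_sum]
    refine (Fintype.sum_equiv (e.toEquiv.arrowCongr (Equiv.refl _)) _ _ fun y => ?_).symm
    rw [← h1]
    rfl
  rw [graphWeight, graphWeight, h1, h2]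

omit [Fintype F] in
theorem placementIndicator_eq_of_iff {t : F} {G : SimpleGraph (Fin n)} {x : Fin n → Fin d → F}
    {p : Prop} [Decidable p] (h : (∀ i j, G.Adj i j → sqNorm (x i - x j) = t) ↔ p) :
    placementIndicator t G x = if p then 1 else 0 := by
  classical
  unfold placementIndicator
  by_cases hp : p
  · rw [if_pos hp, if_pos (h.2 hp)]
  · rw [if_neg hp, if_neg (fun hh => hp (h.1 hh))]

omit [Fintype F] in
theorem forall_adj_fromEdgeSet (t : F) (s : Set (Sym2 (Fin n))) (x : Fin n → Fin d → F) :
    (∀ i j, (SimpleGraph.fromEdgeSet s).Adj i j → sqNorm (x i - x j) = t) ↔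
      ∀ i j, i < j → s(i, j) ∈ s → sqNorm (x i - x j) = t := by
  constructor
  · intro h i j hij hs
    exact h i j ((SimpleGraph.fromEdgeSet_adj s).2 ⟨hs, hij.ne⟩)
  · intro h i j hij
    rw [SimpleGraph.fromEdgeSet_adj] at hij
    rcases lt_or_gt_of_ne hij.2 with hlt | hlt
    · exact h i j hlt hij.1
    · rw [sqNorm_sub_comm]
      exact h j i hlt (Sym2.eq_swap ▸ hij.1)

omit [Fintype F] in
theorem placementIndicator_graphP2 (t : F) (x : Fin 3 → Fin d → F) :
    placementIndicator t graphP2 x = sphereKernel t (x 0) (x 1) * sphereKernel t (x 1) (x 2) := by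
  classical
  rw [placementIndicator_eq_of_iff (p := sqNorm (x 0 - x 1) = t ∧ sqNorm (x 1 - x 2) = t)]
  · simp only [sphereKernel, ite_and]
    split_ifs <;> simp
  · rw [graphP2, forall_adj_fromEdgeSet]
    simp [Fin.forall_fin_succ]

omit [Fintype F] in
theorem placementIndicator_graphP3 (t : F) (x : Fin 4 → Fin d → F) :
    placementIndicator t graphP3 x = sphereKernel t (x 0) (x 1) * sphereKernel t (x 1) (x 2) *
      sphereKernel t (x 2) (x 3) := by
  classical
  rw [placementIndicator_eq_of_iff (p := sqNorm (x 0 - x 1) = t ∧ sqNorm (x 1 - x 2) = t ∧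
    sqNorm (x 2 - x 3) = t)]
  · simp only [sphereKernel, ite_and]
    split_ifs <;> simp
  · rw [graphP3, forall_adj_fromEdgeSet]
    simp [Fin.forall_fin_succ]

omit [Fintype F] in
theorem placementIndicator_graphK3Tail (t : F) (x : Fin 4 → Fin d → F) :
    placementIndicator t graphK3Tail x = triangleWeight (sphereKernel t)
      (fun i => x i.castSucc) * sphereKernel t (x 2) (x 3) := by
  classical
  rw [placementIndicator_eq_of_iff (p := sqNorm (x 0 - x 1) = t ∧ sqNorm (x 1 - x 2) = t ∧
    sqNorm (x 0 - x 2) = t ∧ sqNorm (x 2 - x 3) = t)]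
  · simp only [triangleWeight, sphereKernel, ite_and, Fin.castSucc_zero, Fin.castSucc_one,
      show (2 : Fin 3).castSucc = (2 : Fin 4) from rfl]
    split_ifs <;> simp
  · rw [graphK3Tail, forall_adj_fromEdgeSet]
    simp [Fin.forall_fin_succ]
    tauto

omit [Fintype F] in
theorem placementIndicator_graphY (t : F) (x : Fin 4 → Fin d → F) :
    placementIndicator t graphY x = sphereKernel t (x 2) (x 1) * sphereKernel t (x 2) (x 0) *
      sphereKernel t (x 2) (x 3) := by
  classical
  rw [placementIndicator_eq_of_iff (p := sqNorm (x 2 - x 1) = t ∧ sqNorm (x 2 - x 0) = t ∧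
    sqNorm (x 2 - x 3) = t)]
  · simp only [sphereKernel, ite_and]
    split_ifs <;> simp
  · rw [graphY, forall_adj_fromEdgeSet]
    simp [Fin.forall_fin_succ]
    rw [sqNorm_sub_comm (x 0), sqNorm_sub_comm (x 1)]
    tauto

end GraphWeight

/-! ### Vertex bounds for the graphs with a leaf -/

section VertexBounds

variable {F : Type} [Field F] [Fintype F] {t : F}

open Classical in
theorem vertexBound_trees (hF : ringChar F ≠ 2) (ht : t ≠ 0) :
    VertexBound (graphWeight (d := 2) t graphP2) (217 ^ 2) ∧
      VertexBound (graphWeight (d := 2) t graphP3) (217 ^ 3) ∧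
      VertexBound (graphWeight (d := 2) t graphY) (217 ^ 3) := by
  have h := isCircleKernel_sphereKernel hF ht
  set q : ℝ := (Fintype.card F : ℝ) with hq
  set D : ℝ := ((Finset.univ.filter fun y : Fin 2 → F => sqNorm y = t).card : ℝ)
  let k : (Fin 2 → F) → (Fin 2 → F) → ℝ := fun x y => sphereKernel t x y / D
  let w₁ : (Fin 1 → Fin 2 → F) → ℝ := fun _ => (q ^ 2)⁻¹
  have n₁ : ∀ x, 0 ≤ w₁ x := fun _ => by positivity
  have s₁ : ∑ x, w₁ x = 1 := by
    have : q ≠ 0 := by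
      have := h.one_le
      positivity
    rw [sum_fin_one_arrow]
    simp only [w₁, Finset.sum_const, Finset.card_univ, nsmul_eq_mul, h.card]
    field_simp
  have v₁ : VertexBound w₁ 1 := vertexBound_one h
  have v₂ := v₁.attachLeaf h n₁ 0
  have n₂ := attachLeaf_nonneg h n₁ 0
  have s₂ := (sum_attachLeaf h w₁ 0).trans s₁
  refine ⟨?_, ?_, ?_⟩
  · have v₃ := v₂.attachLeaf h n₂ 1
    have s₃ := (sum_attachLeaf h _ 1).trans s₂
    have := eq_graphWeight_comp (t := t) (G := graphP2) (Equiv.refl _) s₃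
      (c := (q ^ 2)⁻¹ / D ^ 2) fun x => by
        rw [placementIndicator_graphP2]
        simp only [attachLeaf, w₁, Equiv.coe_refl, Function.comp_id]
        change (q ^ 2)⁻¹ * (sphereKernel t (x 0) (x 1) / D) * (sphereKernel t (x 1) (x 2) / D) = _
        ring
    rw [this] at v₃
    exact v₃.mono (by norm_num)
  · have v₃ := v₂.attachLeaf h n₂ 1
    have n₃ := attachLeaf_nonneg h n₂ 1
    have v₄ := v₃.attachLeaf h n₃ 2
    have s₄ := (sum_attachLeaf h _ 2).trans ((sum_attachLeaf h _ 1).trans s₂)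
    have := eq_graphWeight_comp (t := t) (G := graphP3) (Equiv.refl _) s₄
      (c := (q ^ 2)⁻¹ / D ^ 3) fun x => by
        rw [placementIndicator_graphP3]
        simp only [attachLeaf, w₁, Equiv.coe_refl, Function.comp_id]
        change (q ^ 2)⁻¹ * (sphereKernel t (x 0) (x 1) / D) * (sphereKernel t (x 1) (x 2) / D) *
          (sphereKernel t (x 2) (x 3) / D) = _
        ring
    rw [this] at v₄
    exact v₄.mono (by norm_num)
  · have v₃ := v₂.attachLeaf h n₂ 0
    have n₃ := attachLeaf_nonneg h n₂ 0
    have v₄ := v₃.attachLeaf h n₃ 0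
    have s₄ := (sum_attachLeaf h _ 0).trans ((sum_attachLeaf h _ 0).trans s₂)
    -- The leaves were attached to the vertex 0, whereas the centre of `graphY` is 2.
    have := eq_graphWeight_comp (t := t) (G := graphY) (Equiv.swap 0 2).symm s₄
      (c := (q ^ 2)⁻¹ / D ^ 3) fun x => by
        rw [placementIndicator_graphY]
        simp only [attachLeaf, w₁]
        change (q ^ 2)⁻¹ * (sphereKernel t (x 0) (x 1) / D) * (sphereKernel t (x 0) (x 2) / D) *
          (sphereKernel t (x 0) (x 3) / D) = _ * (sphereKernel t (x 0) (x 1) *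
          sphereKernel t (x 0) (x 2) * sphereKernel t (x 0) (x 3))
        ring
    rw [this] at v₄
    exact (VertexBound.reindex _ v₄).mono (by norm_num)

theorem vertexBound_triangles (hF : ringChar F ≠ 2) (h3 : IsSquare (3 : F)) (ht : t ≠ 0) :
    VertexBound (graphWeight (d := 2) t graphK3Tail) (217 * 2604) := by
  classical
  have h := isCircleKernel_sphereKernel hF ht
  have hN := card_cube_le_sum_triangleWeight hF h3 ht
  set q : ℝ := (Fintype.card F : ℝ) with hq
  set D : ℝ := ((Finset.univ.filter fun y : Fin 2 → F => sqNorm y = t).card : ℝ)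
  set N : ℝ := ∑ x, triangleWeight (sphereKernel (d := 2) t) x with hNdef
  have hN0 : N ≠ 0 := by
    have := pow_pos (lt_of_lt_of_le one_pos h.one_le) 3
    intro h0
    rw [h0] at hN
    linarith
  have n₁ : ∀ x, 0 ≤ triangleWeight (sphereKernel (d := 2) t) x / N := fun x => by
    refine div_nonneg ?_ (Finset.sum_nonneg fun y _ => ?_) <;>
      exact mul_nonneg (mul_nonneg (h.nonneg _ _) (h.nonneg _ _)) (h.nonneg _ _)
  have v₂ := (vertexBound_triangle h hNdef hN).attachLeaf h n₁ 2
  have s₂ := (sum_attachLeaf h (fun x => triangleWeight (sphereKernel (d := 2) t) x / N) 2).trans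
    (by rw [← Finset.sum_div, ← hNdef, div_self hN0])
  have := eq_graphWeight_comp (t := t) (G := graphK3Tail) (Equiv.refl _) s₂
    (c := 1 / (N * D)) fun x => by
      rw [placementIndicator_graphK3Tail]
      simp only [attachLeaf, Equiv.coe_refl, Function.comp_id]
      change triangleWeight _ _ / N * (sphereKernel t (x 2) (x 3) / D) = _
      ring
  rw [this] at v₂
  exact v₂

end VertexBounds

/-! ### From densities to norms -/

section Transfer

variable {F : Type} [Field F] [Fintype F] {d n : ℕ}

theorem avgNorm_nonneg (p : ℝ≥0∞) (f : (Fin d → F) → ℝ) : 0 ≤ avgNorm p f := by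
  unfold avgNorm
  split_ifs
  · exact Real.iSup_nonneg fun x => abs_nonneg _
  · refine Real.rpow_nonneg (mul_nonneg (by positivity) ?_) _
    exact Finset.sum_nonneg fun x _ => Real.rpow_nonneg (abs_nonneg _) _

/-- A non-negative function is dominated by its norm times a power of a density. -/
theorem exists_density_of_avgNorm {p : ℝ≥0∞} (hp : 1 ≤ p) {f : (Fin d → F) → ℝ}
    (hf : ∀ x, 0 ≤ f x) :
    ∃ φ : (Fin d → F) → ℝ, IsDensity φ ∧ ∀ x, f x ≤ avgNorm p f * φ x ^ p.toReal⁻¹ := by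
  by_cases hpt : p = ∞
  -- Since `∞.toReal⁻¹ = 0`, the power of the density is one and the supremum alone must dominate f.
  · refine ⟨fun _ => 1, isDensity_one, fun x => ?_⟩
    rw [Real.one_rpow, mul_one, avgNorm, if_pos hpt]
    refine (le_abs_self _).trans (le_ciSup (f := fun x => |f x|) ?_ x)
    exact Set.Finite.bddAbove (Set.finite_range _)
  have hp1 : 1 ≤ p.toReal := by
    rw [← ENNReal.toReal_one]
    exact ENNReal.toReal_mono hpt hp
  have hp0 : 0 < p.toReal := by linarith
  have hcard : (0 : ℝ) < (Fintype.card F : ℝ) ^ d := by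
    have : 0 < Fintype.card F := Fintype.card_pos
    positivity
  have hS : 0 ≤ ∑ x, f x ^ p.toReal := Finset.sum_nonneg fun x _ => Real.rpow_nonneg (hf x) _
  set N := avgNorm p f with hN
  have hNp : N ^ p.toReal = ((Fintype.card F : ℝ) ^ d)⁻¹ * ∑ x, f x ^ p.toReal := by
    rw [hN, avgNorm, if_neg hpt]
    simp only [abs_of_nonneg (hf _)]
    rw [← Real.rpow_mul (mul_nonneg (by positivity) hS), one_div_mul_cancel hp0.ne', Real.rpow_one]
  rcases (avgNorm_nonneg p f).eq_or_lt with h0 | hpos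
  · refine ⟨fun _ => 1, isDensity_one, fun x => ?_⟩
    rw [← hN] at h0
    rw [← h0, Real.zero_rpow hp0.ne'] at hNp
    have hz : ∑ x, f x ^ p.toReal = 0 := by
      rcases mul_eq_zero.1 hNp.symm with h | h
      · exact absurd h (by positivity)
      · exact h
    have := (Finset.sum_eq_zero_iff_of_nonneg fun x _ => Real.rpow_nonneg (hf x) _).1 hz x
      (Finset.mem_univ x)
    rw [Real.rpow_eq_zero (hf x) hp0.ne'] at this
    rw [this, ← h0, zero_mul]
  · rw [← hN] at hpos
    refine ⟨fun x => (f x / N) ^ p.toReal, ⟨fun x => Real.rpow_nonneg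
      (div_nonneg (hf x) hpos.le) _, ?_⟩, fun x => ?_⟩
    · simp only [Real.div_rpow (hf _) hpos.le]
      rw [← Finset.sum_div, hNp, div_le_iff₀ (by rw [← hNp]; positivity)]
      simp only [Fintype.card_pi, Finset.prod_const, Finset.card_univ, Fintype.card_fin,
        Nat.cast_pow]
      rw [mul_inv_cancel_left₀ hcard.ne']
    · rw [← Real.rpow_mul (div_nonneg (hf x) hpos.le), mul_inv_cancel₀ hp0.ne', Real.rpow_one,
        mul_div_cancel₀ _ hpos.ne']

theorem isFormBound_of_powerBound {t : F} {G : SimpleGraph (Fin n)} {p : Fin n → ℝ≥0∞}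
    (hp : ∀ i, 1 ≤ p i) {C : ℝ≥0}
    (h : PowerBound (graphWeight (d := d) t G) (fun i => (p i).toReal⁻¹) C) :
    IsFormBound d t G p C := by
  intro f hf
  choose φ hφ hfφ using fun i => exists_density_of_avgNorm (hp i) (hf i)
  have hP : 0 ≤ ∏ i, avgNorm (p i) (f i) := Finset.prod_nonneg fun i _ => avgNorm_nonneg _ _
  rw [graphForm_eq_sum]
  calc _ ≤ ∑ x : Fin n → Fin d → F, graphWeight t G x *
        ∏ i, (avgNorm (p i) (f i) * φ i (x i) ^ (p i).toReal⁻¹) := by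
        refine Finset.sum_le_sum fun x _ => ?_
        refine mul_le_mul_of_nonneg_left ?_ (graphWeight_nonneg t G x)
        exact Finset.prod_le_prod (fun i _ => hf i _) fun i _ => hfφ i _
    _ = (∑ x : Fin n → Fin d → F, graphWeight t G x * ∏ i, φ i (x i) ^ (p i).toReal⁻¹) *
        ∏ i, avgNorm (p i) (f i) := by
        rw [Finset.sum_mul]
        refine Finset.sum_congr rfl fun x _ => ?_
        rw [Finset.prod_mul_distrib]
        ring
    _ ≤ C * ∏ i, avgNorm (p i) (f i) := mul_le_mul_of_nonneg_right (h φ hφ) hP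

theorem formBounded_of_mem_exponentRegion {t : ∀ (F : Type) [Field F] [Fintype F], F}
    {G : SimpleGraph (Fin n)} {p : Fin n → ℝ≥0∞} (hp : ∀ i, 1 ≤ p i)
    (hG : ∃ C : ℝ≥0, ∀ (F : Type) [Field F] [Fintype F], IsAdmissibleField d F →
      VertexBound (graphWeight (d := d) (t F) G) C)
    (ha : (fun i => (p i).toReal⁻¹) ∈ exponentRegion (Fin n)) : FormBounded d t G p := by
  obtain ⟨C, hC⟩ := hG
  refine ⟨max 1 C, le_max_left _ _, fun F _ _ hF => ?_⟩
  rw [formNorm_le_coe_iff]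
  refine isFormBound_of_powerBound hp (PowerBound.mono
    ((hC F hF).powerBound (graphWeight_nonneg _ _) ha) ?_)
  exact_mod_cast le_max_right 1 C

theorem FormBounded.formRestrictedBounded {t : ∀ (F : Type) [Field F] [Fintype F], F}
    {G : SimpleGraph (Fin n)} {p : Fin n → ℝ≥0∞} (h : FormBounded d t G p) :
    FormRestrictedBounded d t G p := by
  obtain ⟨C, hC, h⟩ := h
  refine ⟨C, hC, fun F _ _ hF E => ?_⟩
  exact (formNorm_le_coe_iff d (t F) G p C).1 (h F hF) _ fun i x =>
    Set.indicator_nonneg (fun _ _ => zero_le_one) x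

end Transfer

/-! ### Inequalities that imply membership in the region -/

section Region

variable {ι : Type*} [DecidableEq ι]

theorem convex_exponentRegion : Convex ℝ (exponentRegion ι) := convex_convexHull ℝ _

/-- A layer-cake decomposition along {i} ⊂ {i, j} ⊂ {i, j, k}: the layers x - y, y - z and z are
multiplied by (|s| + 1)/2 to undo the normalization of `vertexExponent`, and the slack in the
inequality becomes the weight of ∅. -/
theorem mem_exponentRegion_of_sorted {i j k : ι} (hij : i ≠ j) (hik : i ≠ k) (hjk : j ≠ k)
    {x y z : ℝ} (hz : 0 ≤ z) (hzy : z ≤ y) (hyx : y ≤ x) (h : 2 * x + y + z ≤ 2) :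
    Pi.single i x + Pi.single j y + Pi.single k z ∈ exponentRegion ι := by
  let S : Fin 4 → Finset ι := ![∅, {i}, {i, j}, {i, j, k}]
  let w : Fin 4 → ℝ := ![1 - (2 * x + y + z) / 2, x - y, 3 / 2 * (y - z), 2 * z]
  have hc : ({i, j, k} : Finset ι).card = 3 := Finset.card_eq_three.2 ⟨i, j, k, hij, hik, hjk, rfl⟩
  have hc' : ({i, j} : Finset ι).card = 2 := Finset.card_pair hij
  have hmem := (convex_exponentRegion (ι := ι)).sum_mem (t := Finset.univ) (w := w)
    (z := fun r => vertexExponent (S r)) (by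
      intro r _
      fin_cases r <;> simp [w] <;> linarith)
    (by
      simp only [w, Fin.sum_univ_four, Matrix.cons_val]
      ring)
    (by
      intro r _
      refine vertexExponent_mem_exponentRegion ?_
      fin_cases r <;> simp [S, hc, hc'])
  convert hmem using 1
  ext l
  simp only [Fin.sum_univ_four, S, w, Matrix.cons_val, Pi.add_apply, Pi.smul_apply, smul_eq_mul,
    vertexExponent, hc, hc', Finset.card_singleton, Finset.mem_insert, Finset.mem_singleton,
    Finset.notMem_empty, if_false, Pi.single_apply]
  by_cases h1 : l = i
  · subst h1
    simp [hij, hik]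
    ring
  · by_cases h2 : l = j
    · subst h2
      simp [h1, hjk]
      ring
    · by_cases h3 : l = k
      · subst h3
        simp [h1, h2]
        ring
      · simp [h1, h2, h3]

theorem mem_exponentRegion_of_three {i j k : ι} (hij : i ≠ j) (hik : i ≠ k) (hjk : j ≠ k)
    {x y z : ℝ} (hx : 0 ≤ x) (hy : 0 ≤ y) (hz : 0 ≤ z) (h1 : 2 * x + y + z ≤ 2)
    (h2 : x + 2 * y + z ≤ 2) (h3 : x + y + 2 * z ≤ 2) :
    Pi.single i x + Pi.single j y + Pi.single k z ∈ exponentRegion ι := by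
  rcases le_total x y with a | a <;> rcases le_total y z with b | b <;>
    rcases le_total x z with c | c
  · convert mem_exponentRegion_of_sorted hjk.symm hik.symm hij.symm hx a b (by linarith) using 1
    abel
  · convert mem_exponentRegion_of_sorted hjk.symm hik.symm hij.symm hx a b (by linarith) using 1
    abel
  · convert mem_exponentRegion_of_sorted hjk hij.symm hik.symm hx c b (by linarith) using 1
    abel
  · convert mem_exponentRegion_of_sorted hij.symm hjk hik hz c a (by linarith) using 1
    abel
  · convert mem_exponentRegion_of_sorted hik.symm hjk.symm hij hy a c (by linarith) using 1
    abel
  · convert mem_exponentRegion_of_sorted hik hij hjk.symm hy b c (by linarith) using 1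
    abel
  · exact mem_exponentRegion_of_sorted hij hik hjk hz b a (by linarith)
  · exact mem_exponentRegion_of_sorted hij hik hjk hz b a (by linarith)

/-- Distributing the exponent of one vertex over two vertices. -/
theorem mem_exponentRegion_split {i j : ι} {b : ι → ℝ} {x y : ℝ} (hx : 0 ≤ x) (hy : 0 ≤ y)
    (hi : b + Pi.single i (x + y) ∈ exponentRegion ι)
    (hj : b + Pi.single j (x + y) ∈ exponentRegion ι) :
    b + Pi.single i x + Pi.single j y ∈ exponentRegion ι := by
  rcases (add_nonneg hx hy).eq_or_lt with h0 | hpos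
  · have hx0 : x = 0 := by linarith
    have hy0 : y = 0 := by linarith
    simpa [hx0, hy0] using hi
  · have := convex_exponentRegion hi hj (a := x / (x + y)) (b := y / (x + y)) (by positivity)
      (by positivity) (by field_simp)
    convert this using 1
    ext l
    simp only [Pi.add_apply, Pi.smul_apply, smul_eq_mul, Pi.single_apply]
    split_ifs <;> field_simp <;> ring

theorem mem_exponentRegion_K3 {a : Fin 3 → ℝ} (ha : ∀ i, 0 ≤ a i)
    (h0 : 2 * a 0 + a 1 + a 2 ≤ 2) (h1 : a 0 + 2 * a 1 + a 2 ≤ 2)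
    (h2 : a 0 + a 1 + 2 * a 2 ≤ 2) : a ∈ exponentRegion (Fin 3) := by
  have := mem_exponentRegion_of_three (i := (0 : Fin 3)) (j := 1) (k := 2) (by decide) (by decide)
    (by decide) (ha 0) (ha 1) (ha 2) h0 h1 h2
  convert this using 1
  ext l
  fin_cases l <;> simp

/-- The inequalities see the vertices 1 and 3 only through a 1 + a 3, so that sum may be put on
either of them, which is the case of three vertices, and then shared out. -/
theorem mem_exponentRegion_C4Diag {a : Fin 4 → ℝ} (ha : ∀ i, 0 ≤ a i)
    (h0 : 2 * a 0 + (a 1 + a 3) + a 2 ≤ 2) (h1 : a 0 + 2 * (a 1 + a 3) + a 2 ≤ 2)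
    (h2 : a 0 + (a 1 + a 3) + 2 * a 2 ≤ 2) : a ∈ exponentRegion (Fin 4) := by
  have := mem_exponentRegion_split (i := (1 : Fin 4)) (j := 3)
    (b := Pi.single 0 (a 0) + Pi.single 2 (a 2)) (ha 1) (ha 3)
    (mem_exponentRegion_of_three (by decide) (by decide) (by decide) (ha 0) (ha 2)
      (add_nonneg (ha 1) (ha 3)) (by linarith) (by linarith) (by linarith))
    (mem_exponentRegion_of_three (by decide) (by decide) (by decide) (ha 0) (ha 2)
      (add_nonneg (ha 1) (ha 3)) (by linarith) (by linarith) (by linarith))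
  convert this using 1
  ext l
  fin_cases l <;> simp

/-- Each pair of opposite vertices enters through its sum. Concentrating each sum on one vertex
leaves two coordinates, and both sums are then shared out in turn. -/
theorem mem_exponentRegion_C4 {a : Fin 4 → ℝ} (ha : ∀ i, 0 ≤ a i)
    (h0 : 2 * (a 0 + a 2) + (a 1 + a 3) ≤ 2) (h1 : (a 0 + a 2) + 2 * (a 1 + a 3) ≤ 2) :
    a ∈ exponentRegion (Fin 4) := by
  have key : ∀ i j : Fin 4, i ≠ j →
      Pi.single i (a 0 + a 2) + Pi.single j (a 1 + a 3) ∈ exponentRegion (Fin 4) := by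
    intro i j hij
    obtain ⟨k, hik, hjk⟩ : ∃ k, i ≠ k ∧ j ≠ k := by
      revert i j
      decide
    have := mem_exponentRegion_of_three hij hik hjk (add_nonneg (ha 0) (ha 2))
      (add_nonneg (ha 1) (ha 3)) le_rfl (by linarith) (by linarith)
      (by linarith [ha 0, ha 1, ha 2, ha 3])
    simpa using this
  have key' : ∀ j : Fin 4, j ≠ 0 → j ≠ 2 →
      Pi.single j (a 1 + a 3) + Pi.single 0 (a 0) + Pi.single 2 (a 2) ∈ exponentRegion (Fin 4) := by
    intro j h0 h2
    refine mem_exponentRegion_split (ha 0) (ha 2) ?_ ?_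
    · rw [add_comm]
      exact key 0 j h0.symm
    · rw [add_comm]
      exact key 2 j h2.symm
  have := mem_exponentRegion_split (i := (1 : Fin 4)) (j := 3)
    (b := Pi.single 0 (a 0) + Pi.single 2 (a 2)) (ha 1) (ha 3)
    (by
      rw [add_comm, ← add_assoc]
      exact key' 1 (by decide) (by decide))
    (by
      rw [add_comm, ← add_assoc]
      exact key' 3 (by decide) (by decide))
  convert this using 1
  ext l
  fin_cases l <;> simp

end Region

/-! ### Invariance under graph isomorphism -/

section Isomorphism

variable {d n m : ℕ}

theorem isFormBound_iso {F : Type} [Field F] [Fintype F] {t : F} {G : SimpleGraph (Fin n)}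
    {G₀ : SimpleGraph (Fin m)} (e : G₀ ≃g G) {p : Fin n → ℝ≥0∞} {C : ℝ≥0}
    (h : IsFormBound d t G p C) : IsFormBound d t G₀ (p ∘ e) C := by
  intro f hf
  have h' := h (fun i => f (e.symm i)) fun i => hf _
  convert h' using 1
  · rw [graphForm_eq_sum, graphForm_eq_sum]
    refine Fintype.sum_equiv (e.toEquiv.arrowCongr (Equiv.refl _)) _ _ fun x => ?_
    congr 1
    · rw [← graphWeight_iso t e x]
      rfl
    · refine Fintype.prod_equiv e.toEquiv _ _ fun i => ?_
      change f i (x i) = f (e.symm (e i)) (x (e.symm (e i)))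
      rw [e.symm_apply_apply]
  · congr 1
    refine Fintype.prod_equiv e.toEquiv _ _ fun i => ?_
    simp

theorem FormBounded.iso {t : ∀ (F : Type) [Field F] [Fintype F], F} {G : SimpleGraph (Fin n)}
    {G₀ : SimpleGraph (Fin m)} (e : G₀ ≃g G) {p : Fin n → ℝ≥0∞} (h : FormBounded d t G p) :
    FormBounded d t G₀ (p ∘ e) := by
  obtain ⟨C, hC, h⟩ := h
  refine ⟨C, hC, fun F _ _ hF => ?_⟩
  rw [formNorm_le_coe_iff]
  exact isFormBound_iso e ((formNorm_le_coe_iff d (t F) G p C).1 (h F hF))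

end Isomorphism

/-! ### Testing the form on the origin and on circles about it -/

section Necessity

variable {n : ℕ}

theorem avgNorm_indicator {F : Type} [Field F] [Fintype F] {d : ℕ} {p : ℝ≥0∞} (hp : 1 ≤ p)
    {E : Finset (Fin d → F)} (hE : E.Nonempty) :
    avgNorm p ((E : Set (Fin d → F)).indicator (1 : (Fin d → F) → ℝ)) =
      ((E.card : ℝ) / (Fintype.card F : ℝ) ^ d) ^ p.toReal⁻¹ := by
  classical
  by_cases hpt : p = ∞
  · rw [avgNorm, if_pos hpt, hpt]
    simp only [ENNReal.toReal_top, inv_zero, Real.rpow_zero]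
    obtain ⟨y, hy⟩ := hE
    refine le_antisymm (ciSup_le fun x => ?_) ?_
    · by_cases hx : x ∈ (E : Set (Fin d → F)) <;> simp [Set.indicator, hx]
    · refine le_trans (le_of_eq ?_) (le_ciSup (Set.Finite.bddAbove (Set.finite_range _)) y)
      simp [hy]
  · have hp0 : p.toReal ≠ 0 := by
      have : 1 ≤ p.toReal := by
        rw [← ENNReal.toReal_one]
        exact ENNReal.toReal_mono hpt hp
      positivity
    rw [avgNorm, if_neg hpt, one_div]
    congr 1
    rw [div_eq_inv_mul]
    congr 1
    have : ∀ x, |(E : Set (Fin d → F)).indicator (1 : (Fin d → F) → ℝ) x| ^ p.toReal =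
        if x ∈ E then 1 else 0 := by
      intro x
      by_cases hx : x ∈ E <;> simp [hx, hp0]
    rw [Finset.sum_congr rfl fun x _ => this x]
    simp

/-- The number of placements of `G` with the vertices in `Z` at the origin and all others on the
circle about the origin. -/
noncomputable def numOriginPlacements {F : Type} [Field F] (d : ℕ) (t : F)
    (G : SimpleGraph (Fin n)) (Z : Finset (Fin n)) : ℕ :=
  Nat.card {x : Fin n → Fin d → F // (∀ i j, G.Adj i j → sqNorm (x i - x j) = t) ∧
    ∀ i, if i ∈ Z then x i = 0 else sqNorm (x i) = t}

/-- The tested form is the proportion of placements of the prescribed shape, at least 1/(Mq²). The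
norms are at most 2q^{-2/p_i} for the origin and 2q^{-1/p_i} for the circle, which has at most 2q of
the q² points. -/
theorem one_le_of_isFormBound {F : Type} [Field F] [Fintype F] {t : F} (hF : ringChar F ≠ 2)
    {G : SimpleGraph (Fin n)} {p : Fin n → ℝ≥0∞} (hp : ∀ i, 1 ≤ p i) {C : ℝ≥0}
    (h : IsFormBound 2 t G p C) (Z : Finset (Fin n)) {M : ℝ}
    (hN : 0 < numPlacements 2 t G)
    (hM : (numPlacements 2 t G : ℝ) ≤
      M * (Fintype.card F : ℝ) ^ 2 * numOriginPlacements 2 t G Z) (hM0 : 0 ≤ M) :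
    1 ≤ M * C * 2 ^ n * (Fintype.card F : ℝ) ^
      (2 - ∑ i, (if i ∈ Z then 2 else 1) * (p i).toReal⁻¹) := by
  classical
  let E : Fin n → Finset (Fin 2 → F) := fun i =>
    if i ∈ Z then {0} else Finset.univ.filter fun y => sqNorm y = t
  have hE : ∀ i, (E i).Nonempty := by
    intro i
    simp only [E]
    split_ifs
    · exact Finset.singleton_nonempty _
    · obtain ⟨y, hy⟩ := exists_sqNorm_eq hF t
      exact ⟨y, by simp [hy]⟩
  have hmem : ∀ i y, y ∈ E i ↔ if i ∈ Z then y = 0 else sqNorm y = t := by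
    intro i y
    simp only [E]
    split_ifs <;> simp
  have hform : graphForm t G (fun i => ((E i : Finset _) : Set (Fin 2 → F)).indicator 1) =
      numOriginPlacements 2 t G Z / numPlacements 2 t G := by
    rw [graphForm_eq_sum]
    simp only [graphWeight, div_mul_eq_mul_div]
    rw [← Finset.sum_div]
    congr 1
    rw [numOriginPlacements, Nat.card_eq_fintype_card, Fintype.card_subtype, ← Finset.sum_boole]
    refine Finset.sum_congr rfl fun x _ => ?_
    unfold placementIndicator
    by_cases h1 : ∀ i j, G.Adj i j → sqNorm (x i - x j) = t
    · by_cases h2 : ∀ i, if i ∈ Z then x i = 0 else sqNorm (x i) = t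
      · rw [if_pos h1, if_pos ⟨h1, h2⟩, one_mul]
        refine Finset.prod_eq_one fun i _ => ?_
        rw [Set.indicator_of_mem (Finset.mem_coe.2 ((hmem i _).2 (h2 i))), Pi.one_apply]
      · rw [if_neg (c := _ ∧ _) (fun h => h2 h.2)]
        push Not at h2
        obtain ⟨i, hi⟩ := h2
        rw [Finset.prod_eq_zero (Finset.mem_univ i), mul_zero]
        exact Set.indicator_of_notMem (fun h => hi ((hmem i _).1 (Finset.mem_coe.1 h))) _
    · rw [if_neg h1, if_neg (fun h => h1 h.1), zero_mul]
  have hb := h (fun i => ((E i : Finset _) : Set (Fin 2 → F)).indicator 1)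
    fun i x => Set.indicator_nonneg (fun _ _ => zero_le_one) x
  set q : ℝ := (Fintype.card F : ℝ) with hq
  have hq0 : 0 < q := by
    rw [hq]
    exact_mod_cast Fintype.card_pos
  have hnorm : ∀ i, avgNorm (p i) (((E i : Finset _) : Set (Fin 2 → F)).indicator 1) ≤
      2 * q ^ (-((if i ∈ Z then 2 else 1) * (p i).toReal⁻¹)) := by
    intro i
    rw [avgNorm_indicator (hp i) (hE i), ← hq]
    have ha0 : 0 ≤ (p i).toReal⁻¹ := inv_nonneg.2 ENNReal.toReal_nonneg
    have ha1 : (p i).toReal⁻¹ ≤ 1 := by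
      by_cases hpt : p i = ∞
      · simp [hpt]
      · refine inv_le_one_of_one_le₀ ?_
        rw [← ENNReal.toReal_one]
        exact ENNReal.toReal_mono hpt (hp i)
    have h2a : (2 : ℝ) ^ (p i).toReal⁻¹ ≤ 2 := Real.rpow_le_self_of_one_le (by norm_num) ha1
    by_cases hi : i ∈ Z
    · have hc : (E i).card = 1 := by simp [E, hi]
      rw [hc, if_pos hi, Nat.cast_one, ← neg_mul, Real.rpow_mul hq0.le, one_div,
        Real.rpow_neg hq0.le, Real.rpow_two]
      have : 0 ≤ ((q ^ 2)⁻¹) ^ (p i).toReal⁻¹ := by positivity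
      linarith
    · have hc : ((E i).card : ℝ) ≤ 2 * q := by
        simp only [E, hi, if_false, hq]
        exact_mod_cast card_circle_le
      rw [if_neg hi, one_mul]
      calc _ ≤ (2 * q / q ^ 2) ^ (p i).toReal⁻¹ := by gcongr
        _ = 2 ^ (p i).toReal⁻¹ * q ^ (-(p i).toReal⁻¹) := by
            rw [show 2 * q / q ^ 2 = 2 * q⁻¹ by field_simp, Real.mul_rpow (by norm_num)
              (by positivity), Real.inv_rpow hq0.le, Real.rpow_neg hq0.le]
        _ ≤ _ := by gcongr
  have hprod : ∏ i, avgNorm (p i) (((E i : Finset _) : Set (Fin 2 → F)).indicator 1) ≤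
      2 ^ n * q ^ (-∑ i, (if i ∈ Z then 2 else 1) * (p i).toReal⁻¹) := by
    refine (Finset.prod_le_prod (fun i _ => avgNorm_nonneg _ _) fun i _ => hnorm i).trans ?_
    rw [Finset.prod_mul_distrib, Finset.prod_const, Finset.card_univ, Fintype.card_fin,
      ← Real.rpow_sum_of_pos hq0, Finset.sum_neg_distrib]
  rw [hform] at hb
  have hN' : (0 : ℝ) < numPlacements 2 t G := by exact_mod_cast hN
  rw [div_le_iff₀ hN'] at hb
  have hb' : (numOriginPlacements 2 t G Z : ℝ) ≤
      C * (2 ^ n * q ^ (-∑ i, (if i ∈ Z then 2 else 1) * (p i).toReal⁻¹)) *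
        numPlacements 2 t G :=
    hb.trans (mul_le_mul_of_nonneg_right (mul_le_mul_of_nonneg_left hprod C.2) hN'.le)
  have h3 := hM.trans (mul_le_mul_of_nonneg_left hb' (by positivity))
  refine le_of_mul_le_mul_right ?_ hN'
  rw [one_mul]
  refine h3.trans (le_of_eq ?_)
  rw [sub_eq_add_neg, Real.rpow_add hq0, Real.rpow_two]
  ring

theorem nonneg_of_one_le_mul_rpow {A s : ℝ}
    (h : ∀ k : ℕ, k ≠ 0 → 1 ≤ A * ((3 : ℝ) ^ k) ^ s) : 0 ≤ s := by
  by_contra! hs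
  have h1 : (3 : ℝ) ^ s < 1 := Real.rpow_lt_one_of_one_lt_of_neg (by norm_num) hs
  have h2 := (tendsto_pow_atTop_nhds_zero_of_lt_one (by positivity) h1).const_mul A
  rw [mul_zero] at h2
  obtain ⟨k, hk, hk0⟩ := ((h2.eventually (gt_mem_nhds one_pos)).and
    (Filter.eventually_ne_atTop 0)).exists
  have h3 := h k hk0
  rw [← Real.rpow_natCast, ← Real.rpow_mul (by norm_num), mul_comm (k : ℝ),
    Real.rpow_mul (by norm_num), Real.rpow_natCast] at h3
  linarith

/-- Testing on the origin and circles about it, in characteristic three. -/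
theorem sum_exponents_le_two {t : ∀ (F : Type) [Field F] [Fintype F], F}
    (ht : ∀ (F : Type) [Field F] [Fintype F], t F ≠ 0) {G : SimpleGraph (Fin n)}
    {p : Fin n → ℝ≥0∞} (hp : ∀ i, 1 ≤ p i) (h : FormBounded 2 t G p) (Z : Finset (Fin n)) {M : ℝ}
    (hM0 : 0 ≤ M)
    (hM : ∀ (F : Type) [Field F] [Fintype F] (t : F), t ≠ 0 → (3 : F) = 0 → ringChar F ≠ 2 →
      0 < numPlacements 2 t G ∧ (numPlacements 2 t G : ℝ) ≤
        M * (Fintype.card F : ℝ) ^ 2 * numOriginPlacements 2 t G Z) :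
    ∑ i, (if i ∈ Z then 2 else 1) * (p i).toReal⁻¹ ≤ 2 := by
  obtain ⟨C, hC, h⟩ := h
  suffices 0 ≤ 2 - ∑ i, (if i ∈ Z then 2 else 1) * (p i).toReal⁻¹ by linarith
  refine nonneg_of_one_le_mul_rpow (A := M * C * 2 ^ n) fun k hk => ?_
  -- The fields with 3^k elements are admissible because 3 = 0 is a square, and their orders are
  -- unbounded, so the exponent of q cannot be negative.
  let _ : Fintype (GaloisField 3 k) := Fintype.ofFinite _
  have h3 : (3 : GaloisField 3 k) = 0 := CharP.cast_eq_zero (GaloisField 3 k) 3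
  have hchar : ringChar (GaloisField 3 k) ≠ 2 := by
    rw [ringChar.eq (GaloisField 3 k) 3]
    norm_num
  have hcard : (Fintype.card (GaloisField 3 k) : ℝ) = 3 ^ k := by
    rw [← Nat.card_eq_fintype_card, GaloisField.card 3 k hk]
    norm_num
  obtain ⟨hN, hN'⟩ := hM (GaloisField 3 k) (t _) (ht _) h3 hchar
  have := one_le_of_isFormBound hchar hp ((formNorm_le_coe_iff 2 _ G p C).1
    (h (GaloisField 3 k) ⟨hchar, fun _ => ⟨0, by simp [h3]⟩⟩)) Z hN hN' hM0
  rwa [hcard] at this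

/-- Every placement is a translate of one with the root i₀ at the origin, and by hypothesis the root
at the origin forces the prescribed shape. -/
theorem numPlacements_le_of_root {F : Type} [Field F] [Fintype F] {t : F}
    {G : SimpleGraph (Fin n)} {Z : Finset (Fin n)} (i₀ : Fin n)
    (h : ∀ x : Fin n → Fin 2 → F, (∀ i j, G.Adj i j → sqNorm (x i - x j) = t) → x i₀ = 0 →
      ∀ i, if i ∈ Z then x i = 0 else sqNorm (x i) = t) :
    (numPlacements 2 t G : ℝ) ≤
      1 * (Fintype.card F : ℝ) ^ 2 * numOriginPlacements 2 t G Z := by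
  classical
  have hle : numPlacements 2 t G ≤ Nat.card ((Fin 2 → F) × {x : Fin n → Fin 2 → F //
      (∀ i j, G.Adj i j → sqNorm (x i - x j) = t) ∧
        ∀ i, if i ∈ Z then x i = 0 else sqNorm (x i) = t}) := by
    refine Nat.card_le_card_of_injective (fun x => (x.1 i₀, ⟨fun i => x.1 i - x.1 i₀, ?_, ?_⟩)) ?_
    · intro i j hij
      rw [sub_sub_sub_cancel_right]
      exact x.2 i j hij
    · refine h _ (fun i j hij => ?_) (sub_self _)
      rw [sub_sub_sub_cancel_right]
      exact x.2 i j hij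
    · intro x y hxy
      simp only [Prod.mk.injEq, Subtype.mk.injEq] at hxy
      ext1
      funext i
      have := congrFun hxy.2 i
      simp only [hxy.1] at this
      exact sub_left_injective this
  rw [Nat.card_prod] at hle
  have hc : Nat.card (Fin 2 → F) = Fintype.card F ^ 2 := by simp
  rw [hc] at hle
  rw [one_mul]
  exact_mod_cast hle

end Necessity

/-! ### Adjacency conditions and equilateral triangles in characteristic three -/

section Adjacency

variable {F : Type} [Field F] {t : F} {d : ℕ}

theorem forall_adj_graphK3 (x : Fin 3 → Fin d → F) :
    (∀ i j, graphK3.Adj i j → sqNorm (x i - x j) = t) ↔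
      sqNorm (x 0 - x 1) = t ∧ sqNorm (x 1 - x 2) = t ∧ sqNorm (x 0 - x 2) = t := by
  rw [graphK3, forall_adj_fromEdgeSet]
  simp [Fin.forall_fin_succ]
  tauto

theorem forall_adj_graphC4 (x : Fin 4 → Fin d → F) :
    (∀ i j, graphC4.Adj i j → sqNorm (x i - x j) = t) ↔
      (sqNorm (x 0 - x 1) = t ∧ sqNorm (x 0 - x 3) = t) ∧
      (sqNorm (x 2 - x 1) = t ∧ sqNorm (x 2 - x 3) = t) := by
  rw [graphC4, forall_adj_fromEdgeSet, sqNorm_sub_comm (x 2) (x 1)]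
  simp [Fin.forall_fin_succ]

theorem forall_adj_graphC4Diag (x : Fin 4 → Fin d → F) :
    (∀ i j, graphC4Diag.Adj i j → sqNorm (x i - x j) = t) ↔
      sqNorm (x 0 - x 2) = t ∧ (sqNorm (x 0 - x 1) = t ∧ sqNorm (x 1 - x 2) = t) ∧
      (sqNorm (x 2 - x 3) = t ∧ sqNorm (x 0 - x 3) = t) := by
  rw [graphC4Diag, forall_adj_fromEdgeSet]
  simp [Fin.forall_fin_succ]
  tauto

omit t in
theorem sqNorm_neg (x : Fin d → F) : sqNorm (-x) = sqNorm x := by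
  simp [sqNorm]

theorem sqNorm_add_self (h3 : (3 : F) = 0) (x : Fin d → F) : sqNorm (x + x) = sqNorm x := by
  unfold sqNorm
  refine Finset.sum_congr rfl fun i _ => ?_
  simp only [Pi.add_apply]
  linear_combination x i ^ 2 * h3

/-- In characteristic three an equilateral triangle consists of three points on a line. -/
theorem add_eq_zero_of_equilateral (h3 : (3 : F) = 0) (ht : t ≠ 0) {x y : Fin 2 → F}
    (hx : sqNorm x = t) (hy : sqNorm y = t) (hxy : sqNorm (x - y) = t) : x + y = 0 := by
  rw [sqNorm_two] at hx hy hxy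
  simp only [Pi.sub_apply] at hxy
  have hdot : (x 0 + y 0) * x 0 + (x 1 + y 1) * x 1 = 0 := by
    linear_combination hxy - hy +
      (x 0 * y 0 + x 1 * y 1) * h3
  -- The equilateral condition reads 2 x·y = t, that is x·y = -t in characteristic three, so
  -- Lagrange's identity gives t² - t² = 0.
  have hcross : (x 0 * y 1 - x 1 * y 0) ^ 2 = 0 := by
    have e : x 0 * y 0 + x 1 * y 1 = -t := by linear_combination hdot - hx
    have e2 : (x 0 * y 1 - x 1 * y 0) ^ 2 =
      (x 0 ^ 2 + x 1 ^ 2) * (y 0 ^ 2 + y 1 ^ 2) - (x 0 * y 0 + x 1 * y 1) ^ 2 := by ring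
    rw [e2, hx, hy, e]
    ring
  have hc : x 0 * y 1 - x 1 * y 0 = 0 := pow_eq_zero_iff two_ne_zero |>.1 hcross
  have e0 : t * (x 0 + y 0) = 0 := by
    rw [← hx]
    linear_combination x 0 * hdot - x 1 * hc
  have e1 : t * (x 1 + y 1) = 0 := by
    rw [← hx]
    linear_combination x 1 * hdot + x 0 * hc
  ext i
  fin_cases i
  · exact (mul_eq_zero.1 e0).resolve_left ht
  · exact (mul_eq_zero.1 e1).resolve_left ht

end Adjacency

/-! ### Counting the test placements -/

section Tests

variable {F : Type} [Field F] [Fintype F] {t : F}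

theorem numPlacements_pos {n : ℕ} {G : SimpleGraph (Fin n)} (x : Fin n → Fin 2 → F)
    (hx : ∀ i j, G.Adj i j → sqNorm (x i - x j) = t) : 0 < numPlacements 2 t G :=
  Nat.card_pos_iff.2 ⟨⟨⟨x, hx⟩⟩, inferInstance⟩

/-- The points 0, y, -y form an equilateral triangle because ‖2y‖ = 4‖y‖ = ‖y‖. The other two
vertices are adjacent to the root, so they lie on the circle about it. -/
theorem placements_graphK3 (h3 : (3 : F) = 0) (hF : ringChar F ≠ 2) :
    0 < numPlacements 2 t graphK3 ∧ (numPlacements 2 t graphK3 : ℝ) ≤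
      1 * (Fintype.card F : ℝ) ^ 2 * numOriginPlacements 2 t graphK3 {0} := by
  obtain ⟨y, hy⟩ := exists_sqNorm_eq hF t
  refine ⟨numPlacements_pos ![0, y, -y] ?_, numPlacements_le_of_root 0 fun x hx h0 => ?_⟩
  · rw [forall_adj_graphK3]
    simp [sqNorm_neg, sqNorm_add_self h3, hy]
  · rw [forall_adj_graphK3, h0] at hx
    simp only [zero_sub, sqNorm_neg] at hx
    simp [Fin.forall_fin_succ, h0, hx]

theorem placements_graphC4Diag_zero (h3 : (3 : F) = 0) (hF : ringChar F ≠ 2) :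
    0 < numPlacements 2 t graphC4Diag ∧ (numPlacements 2 t graphC4Diag : ℝ) ≤
      1 * (Fintype.card F : ℝ) ^ 2 * numOriginPlacements 2 t graphC4Diag {0} := by
  obtain ⟨y, hy⟩ := exists_sqNorm_eq hF t
  refine ⟨numPlacements_pos ![0, -y, y, -y] ?_, numPlacements_le_of_root 0 fun x hx h0 => ?_⟩
  · rw [forall_adj_graphC4Diag, sqNorm_sub_comm (_ : Fin 2 → F) (![0, -y, y, -y] 2)]
    simp [sqNorm_neg, sqNorm_add_self h3, hy, show -y - y = -(y + y) by abel]
  · rw [forall_adj_graphC4Diag, h0] at hx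
    simp only [zero_sub, sqNorm_neg] at hx
    simp [Fin.forall_fin_succ, h0, hx]

/-- In characteristic three the vertices 1 and 3 are both the midpoint of the edge between 0 and 2.
They therefore coincide, and both can be put at the origin at no cost. -/
theorem numPlacements_graphC4Diag_le (h3 : (3 : F) = 0) (ht : t ≠ 0) :
    (numPlacements 2 t graphC4Diag : ℝ) ≤
      1 * (Fintype.card F : ℝ) ^ 2 * numOriginPlacements 2 t graphC4Diag {1, 3} := by
  refine numPlacements_le_of_root 1 fun x hx h1 => ?_
  rw [forall_adj_graphC4Diag] at hx
  obtain ⟨h02, ⟨h01, h12⟩, h23, h03⟩ := hx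
  have e1 := add_eq_zero_of_equilateral h3 ht (x := x 0 - x 1) (y := x 2 - x 1) h01
    (by rwa [sqNorm_sub_comm]) (by rwa [sub_sub_sub_cancel_right])
  have e3 := add_eq_zero_of_equilateral h3 ht (x := x 0 - x 3) (y := x 2 - x 3) h03
    h23 (by rwa [sub_sub_sub_cancel_right])
  have hx3 : x 3 = 0 := by
    rw [h1] at e1
    have h2 : x 3 + x 3 = 0 := by
      have : x 3 + x 3 = (x 0 - 0 + (x 2 - 0)) - (x 0 - x 3 + (x 2 - x 3)) := by abel
      rw [this, e1, e3, sub_zero]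
    funext i
    have h4 : x 3 i + x 3 i = 0 := congrFun h2 i
    simp only [Pi.zero_apply]
    linear_combination x 3 i * h3 - h4
  rw [h1, sub_zero] at h01
  rw [h1, zero_sub, sqNorm_neg] at h12
  simp [Fin.forall_fin_succ, h1, hx3, h01, h12]

theorem sum_fin_four_arrow {V : Type*} [Fintype V] (g : (Fin 4 → V) → ℝ) :
    ∑ x, g x = ∑ a, ∑ b, ∑ c, ∑ e, g ![a, b, c, e] := by
  rw [sum_fin_succ_arrow, sum_fin_three_arrow]
  refine Finset.sum_congr rfl fun a _ => Finset.sum_congr rfl fun b _ =>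
    Finset.sum_congr rfl fun c _ => Finset.sum_congr rfl fun e _ => ?_
  congr 1
  ext i
  fin_cases i <;> rfl

/-- Letting 0 and 2 coincide loses only a constant. The number of placements is the sum over b, e of
the squared number of common neighbours: b = e contributes q²|S|², and for b ≠ e one factor is at
most two, which leaves at most 2q²|S|². With 0 and 2 both at the origin, 1 and 3 are free on the
circle S. -/
theorem placements_graphC4 (hF : ringChar F ≠ 2) (ht : t ≠ 0) :
    0 < numPlacements 2 t graphC4 ∧ (numPlacements 2 t graphC4 : ℝ) ≤
      3 * (Fintype.card F : ℝ) ^ 2 * numOriginPlacements 2 t graphC4 {0, 2} := by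
  classical
  have h := isCircleKernel_sphereKernel hF ht
  refine ⟨?_, ?_⟩
  · obtain ⟨y, hy⟩ := exists_sqNorm_eq hF t
    refine numPlacements_pos ![0, y, 0, y] ?_
    rw [forall_adj_graphC4]
    simp [sqNorm_neg, hy]
  set S := Finset.univ.filter fun y : Fin 2 → F => sqNorm y = t with hS
  have hlow : S.card ^ 2 ≤ numOriginPlacements 2 t graphC4 {0, 2} := by
    rw [sq, ← Fintype.card_coe, ← Fintype.card_prod, ← Nat.card_eq_fintype_card]
    refine Nat.card_le_card_of_injective
      (fun y : S × S => ⟨![0, y.1.1, 0, y.2.1], ?_, ?_⟩) ?_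
    · have h1 := (Finset.mem_filter.1 y.1.2).2
      have h2 := (Finset.mem_filter.1 y.2.2).2
      rw [forall_adj_graphC4]
      simp [sqNorm_neg, h1, h2]
    · have h1 := (Finset.mem_filter.1 y.1.2).2
      have h2 := (Finset.mem_filter.1 y.2.2).2
      simp [Fin.forall_fin_succ, h1, h2]
    · intro y z hyz
      simp only [Subtype.mk.injEq] at hyz
      have h1 := congrFun hyz 1
      have h2 := congrFun hyz 3
      ext1
      · exact Subtype.ext h1
      · exact Subtype.ext h2
  set K : (Fin 2 → F) → (Fin 2 → F) → ℝ := sphereKernel t with hK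
  have hup : (numPlacements 2 t graphC4 : ℝ) =
      ∑ b, ∑ e, (∑ a, K a b * K a e) * ∑ c, K c b * K c e := by
    rw [numPlacements_eq_sum, sum_fin_four_arrow]
    have : ∀ a b c e : Fin 2 → F, placementIndicator t graphC4 ![a, b, c, e] =
        (K a b * K a e) * (K c b * K c e) := by
      intro a b c e
      rw [placementIndicator_eq_of_iff (forall_adj_graphC4 _)]
      simp only [hK, sphereKernel, Matrix.cons_val]
      by_cases h1 : sqNorm (a - b) = t <;> by_cases h2 : sqNorm (a - e) = t <;>
        by_cases h3 : sqNorm (c - b) = t <;> by_cases h4 : sqNorm (c - e) = t <;>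
        simp [h1, h2, h3, h4]
    simp only [this]
    calc _ = ∑ b, ∑ a, ∑ c, ∑ e, (K a b * K a e) * (K c b * K c e) := Finset.sum_comm
      _ = ∑ b, ∑ a, ∑ e, ∑ c, (K a b * K a e) * (K c b * K c e) :=
          Finset.sum_congr rfl fun b _ => Finset.sum_congr rfl fun a _ => Finset.sum_comm
      _ = ∑ b, ∑ e, ∑ a, ∑ c, (K a b * K a e) * (K c b * K c e) :=
          Finset.sum_congr rfl fun b _ => Finset.sum_comm
      _ = _ := Finset.sum_congr rfl fun b _ => Finset.sum_congr rfl fun e _ =>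
          (Finset.sum_mul_sum _ _ _ _).symm
  have hcol : ∀ b, ∑ a, K a b = S.card := fun b => by
    rw [← h.degree b]
    exact Finset.sum_congr rfl fun a _ => h.symm a b
  have hcn : ∀ b e, 0 ≤ ∑ a, K a b * K a e := fun b e =>
    Finset.sum_nonneg fun a _ => mul_nonneg (h.nonneg _ _) (h.nonneg _ _)
  have hbound : (numPlacements 2 t graphC4 : ℝ) ≤
      3 * (Fintype.card F : ℝ) ^ 2 * (S.card : ℝ) ^ 2 := by
    rw [hup]
    calc _ ≤ ∑ b, ∑ e, ((if b = e then (S.card : ℝ) ^ 2 else 0) +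
          2 * ∑ a, K a b * K a e) := by
          refine Finset.sum_le_sum fun b _ => Finset.sum_le_sum fun e _ => ?_
          by_cases hbe : b = e
          · subst hbe
            have : ∑ a, K a b * K a b = S.card := by
              rw [← hcol b]
              exact Finset.sum_congr rfl fun a _ => h.mul_self a b
            rw [this, if_pos rfl, sq]
            linarith [(Nat.cast_nonneg S.card : (0 : ℝ) ≤ S.card)]
          · have h2 := h.common_le b e
            rw [if_neg hbe, zero_add] at h2
            rw [if_neg hbe, zero_add]
            exact mul_le_mul_of_nonneg_right h2 (hcn b e)
      _ = 3 * (Fintype.card F : ℝ) ^ 2 * (S.card : ℝ) ^ 2 := by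
          have e1 : ∑ b, ∑ e, ∑ a, K a b * K a e =
              (Fintype.card F : ℝ) ^ 2 * (S.card : ℝ) ^ 2 := by
            calc _ = ∑ a, ∑ b, ∑ e, K a b * K a e := by
                  rw [Finset.sum_congr rfl fun b _ => Finset.sum_comm, Finset.sum_comm]
              _ = ∑ a : Fin 2 → F, (S.card : ℝ) ^ 2 := by
                  refine Finset.sum_congr rfl fun a _ => ?_
                  rw [← Finset.sum_mul_sum, h.degree, sq]
              _ = _ := by rw [Finset.sum_const, Finset.card_univ, nsmul_eq_mul, h.card]
          simp only [Finset.sum_add_distrib, ← Finset.mul_sum]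
          rw [e1]
          simp only [Finset.sum_ite_eq, Finset.mem_univ, if_true, Finset.sum_const,
            Finset.card_univ, nsmul_eq_mul, h.card]
          ring
  refine hbound.trans (mul_le_mul_of_nonneg_left ?_ (by positivity))
  exact_mod_cast hlow

end Tests

/-! ### Boundedness forces the exponents into the region -/

section Necessary

variable {t : ∀ (F : Type) [Field F] [Fintype F], F}

/-- Automorphisms carry the doubled vertex to each of the three positions, giving the three
inequalities of `mem_exponentRegion_K3`. -/
theorem mem_exponentRegion_of_formBounded_K3
    (ht : ∀ (F : Type) [Field F] [Fintype F], t F ≠ 0) {p : Fin 3 → ℝ≥0∞} (hp : ∀ i, 1 ≤ p i)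
    (h : FormBounded 2 t graphK3 p) : (fun i => (p i).toReal⁻¹) ∈ exponentRegion (Fin 3) := by
  have key : ∀ e : graphK3 ≃g graphK3, ∑ i, (if i ∈ ({0} : Finset (Fin 3)) then 2 else 1) *
      ((p ∘ e) i).toReal⁻¹ ≤ 2 := fun e =>
    sum_exponents_le_two ht (fun i => hp _) (h.iso e) {0} zero_le_one
      fun F _ _ t _ h3 hF => placements_graphK3 h3 hF
  have aut : ∀ σ : Equiv.Perm (Fin 3), ∀ i j, graphK3.Adj (σ i) (σ j) ↔ graphK3.Adj i j := by
    have hadj : ∀ i j, graphK3.Adj i j ↔ i ≠ j := by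
      intro i j
      rw [graphK3, SimpleGraph.fromEdgeSet_adj]
      fin_cases i <;> fin_cases j <;> simp
    intro σ i j
    rw [hadj, hadj, σ.injective.ne_iff]
  have k0 := key ⟨Equiv.refl _, fun {i j} => aut _ i j⟩
  have k1 := key ⟨Equiv.swap 0 1, fun {i j} => aut _ i j⟩
  have k2 := key ⟨Equiv.swap 0 2, fun {i j} => aut _ i j⟩
  rw [Fin.sum_univ_three] at k0 k1 k2
  refine mem_exponentRegion_K3 (fun i => inv_nonneg.2 ENNReal.toReal_nonneg) ?_ ?_ ?_
  · change 2 * (p 0).toReal⁻¹ + 1 * (p 1).toReal⁻¹ + 1 * (p 2).toReal⁻¹ ≤ 2 at k0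
    linarith
  · change 2 * (p 1).toReal⁻¹ + 1 * (p 0).toReal⁻¹ + 1 * (p 2).toReal⁻¹ ≤ 2 at k1
    linarith
  · change 2 * (p 2).toReal⁻¹ + 1 * (p 1).toReal⁻¹ + 1 * (p 0).toReal⁻¹ ≤ 2 at k2
    linarith

/-- The vertices 0 and 2 of degree three are put at the origin one at a time, the vertices 1 and 3
together. -/
theorem mem_exponentRegion_of_formBounded_C4Diag
    (ht : ∀ (F : Type) [Field F] [Fintype F], t F ≠ 0) {p : Fin 4 → ℝ≥0∞} (hp : ∀ i, 1 ≤ p i)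
    (h : FormBounded 2 t graphC4Diag p) :
    (fun i => (p i).toReal⁻¹) ∈ exponentRegion (Fin 4) := by
  have key : ∀ e : graphC4Diag ≃g graphC4Diag, ∑ i, (if i ∈ ({0} : Finset (Fin 4)) then 2 else 1) *
      ((p ∘ e) i).toReal⁻¹ ≤ 2 := fun e =>
    sum_exponents_le_two ht (fun i => hp _) (h.iso e) {0} zero_le_one
      fun F _ _ t _ h3 hF => placements_graphC4Diag_zero h3 hF
  have k1 := sum_exponents_le_two ht hp h {1, 3} zero_le_one fun F _ _ t ht h3 hF =>
    ⟨(placements_graphC4Diag_zero h3 hF).1, numPlacements_graphC4Diag_le h3 ht⟩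
  have aut : ∀ i j, graphC4Diag.Adj (Equiv.swap 0 2 i) (Equiv.swap 0 2 j) ↔
      graphC4Diag.Adj i j := by
    intro i j
    rw [graphC4Diag, SimpleGraph.fromEdgeSet_adj, SimpleGraph.fromEdgeSet_adj]
    revert i j
    decide
  have k0 := key (RelIso.refl _)
  have k2 := key ⟨Equiv.swap 0 2, fun {i j} => aut i j⟩
  rw [Fin.sum_univ_four] at k0 k1 k2
  refine mem_exponentRegion_C4Diag (fun i => inv_nonneg.2 ENNReal.toReal_nonneg) ?_ ?_ ?_
  · change 2 * (p 0).toReal⁻¹ + 1 * (p 1).toReal⁻¹ + 1 * (p 2).toReal⁻¹ +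
      1 * (p 3).toReal⁻¹ ≤ 2 at k0
    linarith
  · change 1 * (p 0).toReal⁻¹ + 2 * (p 1).toReal⁻¹ + 1 * (p 2).toReal⁻¹ +
      2 * (p 3).toReal⁻¹ ≤ 2 at k1
    linarith
  · change 2 * (p 2).toReal⁻¹ + 1 * (p 1).toReal⁻¹ + 1 * (p 0).toReal⁻¹ +
      1 * (p 3).toReal⁻¹ ≤ 2 at k2
    linarith

theorem mem_exponentRegion_of_formBounded_C4
    (ht : ∀ (F : Type) [Field F] [Fintype F], t F ≠ 0) {p : Fin 4 → ℝ≥0∞} (hp : ∀ i, 1 ≤ p i)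
    (h : FormBounded 2 t graphC4 p) : (fun i => (p i).toReal⁻¹) ∈ exponentRegion (Fin 4) := by
  have key : ∀ e : graphC4 ≃g graphC4, ∑ i, (if i ∈ ({0, 2} : Finset (Fin 4)) then 2 else 1) *
      ((p ∘ e) i).toReal⁻¹ ≤ 2 := fun e =>
    sum_exponents_le_two ht (fun i => hp _) (h.iso e) {0, 2} (by norm_num : (0 : ℝ) ≤ 3)
      fun F _ _ t ht _ hF => placements_graphC4 hF ht
  have aut : ∀ i j, graphC4.Adj (finRotate 4 i) (finRotate 4 j) ↔ graphC4.Adj i j := by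
    intro i j
    rw [graphC4, SimpleGraph.fromEdgeSet_adj, SimpleGraph.fromEdgeSet_adj]
    revert i j
    decide
  have k0 := key (RelIso.refl _)
  have k1 := key ⟨finRotate 4, fun {i j} => aut i j⟩
  rw [Fin.sum_univ_four] at k0 k1
  refine mem_exponentRegion_C4 (fun i => inv_nonneg.2 ENNReal.toReal_nonneg) ?_ ?_
  · change 2 * (p 0).toReal⁻¹ + 1 * (p 1).toReal⁻¹ + 2 * (p 2).toReal⁻¹ +
      1 * (p 3).toReal⁻¹ ≤ 2 at k0
    linarith
  · change 2 * (p 1).toReal⁻¹ + 1 * (p 2).toReal⁻¹ + 2 * (p 3).toReal⁻¹ +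
      1 * (p 0).toReal⁻¹ ≤ 2 at k1
    linarith

end Necessary

theorem mem_exponentRegion_of_comp {ι κ : Type*} [DecidableEq ι] [DecidableEq κ] (e : κ ≃ ι)
    {a : ι → ℝ} (h : a ∘ e ∈ exponentRegion κ) : a ∈ exponentRegion ι := by
  have hsub : exponentRegion κ ⊆ {b | b ∘ e.symm ∈ exponentRegion ι} := by
    refine convexHull_min ?_ fun b hb c hc r s hr hs hrs => convex_exponentRegion hb hc hr hs hrs
    rintro _ ⟨s, hs, rfl⟩
    change vertexExponent s ∘ e.symm ∈ exponentRegion ι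
    rw [vertexExponent_comp]
    exact vertexExponent_mem_exponentRegion (by simpa using hs)
  have := hsub h
  simpa [Function.comp_def] using this

/-! ### Minimum degrees of the graphs -/

section MinDegree

instance : DecidableRel graphK3.Adj :=
  inferInstanceAs (DecidableRel (SimpleGraph.fromEdgeSet {s(0, 1), s(1, 2), s(2, 0)}).Adj)

instance : DecidableRel graphP2.Adj :=
  inferInstanceAs (DecidableRel (SimpleGraph.fromEdgeSet {s(0, 1), s(1, 2)}).Adj)

instance : DecidableRel graphC4Diag.Adj :=
  inferInstanceAs (DecidableRel
    (SimpleGraph.fromEdgeSet {s(0, 1), s(1, 2), s(2, 3), s(3, 0), s(0, 2)}).Adj)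

instance : DecidableRel graphC4.Adj :=
  inferInstanceAs (DecidableRel
    (SimpleGraph.fromEdgeSet {s(0, 1), s(1, 2), s(2, 3), s(3, 0)}).Adj)

instance : DecidableRel graphP3.Adj :=
  inferInstanceAs (DecidableRel (SimpleGraph.fromEdgeSet {s(0, 1), s(1, 2), s(2, 3)}).Adj)

instance : DecidableRel graphK3Tail.Adj :=
  inferInstanceAs (DecidableRel
    (SimpleGraph.fromEdgeSet {s(0, 1), s(1, 2), s(2, 0), s(2, 3)}).Adj)

instance : DecidableRel graphY.Adj :=
  inferInstanceAs (DecidableRel (SimpleGraph.fromEdgeSet {s(2, 0), s(2, 1), s(2, 3)}).Adj)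

theorem minDegree_graphK3 : graphK3.minDegree = 2 := by decide

theorem minDegree_graphC4 : graphC4.minDegree = 2 := by decide

theorem minDegree_graphC4Diag : graphC4Diag.minDegree = 2 := by decide

theorem minDegree_graphP2 : graphP2.minDegree = 1 := by decide

theorem minDegree_graphP3 : graphP3.minDegree = 1 := by decide

theorem minDegree_graphK3Tail : graphK3Tail.minDegree = 1 := by decide

theorem minDegree_graphY : graphY.minDegree = 1 := by decide

variable {n : ℕ} {G : SimpleGraph (Fin n)} [DecidableRel G.Adj]

theorem IsStudiedGraph.one_le_minDegree (hG : IsStudiedGraph G) : 1 ≤ G.minDegree := by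
  rcases hG with ⟨⟨e⟩⟩ | ⟨⟨e⟩⟩ | ⟨⟨e⟩⟩ | ⟨⟨e⟩⟩ | ⟨⟨e⟩⟩ | ⟨⟨e⟩⟩ | ⟨⟨e⟩⟩ <;> rw [← e.minDegree_eq]
  · exact minDegree_graphK3 ▸ one_le_two
  · exact minDegree_graphP2.ge
  · exact minDegree_graphC4Diag ▸ one_le_two
  · exact minDegree_graphC4 ▸ one_le_two
  · exact minDegree_graphP3.ge
  · exact minDegree_graphK3Tail.ge
  · exact minDegree_graphY.ge

theorem IsStudiedGraph.of_minDegree_le_one (hG : IsStudiedGraph G) (h : G.minDegree ≤ 1) :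
    Nonempty (graphP2 ≃g G) ∨ Nonempty (graphP3 ≃g G) ∨ Nonempty (graphK3Tail ≃g G) ∨
      Nonempty (graphY ≃g G) := by
  rcases hG with ⟨⟨e⟩⟩ | h' | ⟨⟨e⟩⟩ | ⟨⟨e⟩⟩ | h' | h' | h'
  · rw [← e.minDegree_eq, minDegree_graphK3] at h
    omega
  · exact .inl h'
  · rw [← e.minDegree_eq, minDegree_graphC4Diag] at h
    omega
  · rw [← e.minDegree_eq, minDegree_graphC4] at h
    omega
  · exact .inr (.inl h')
  · exact .inr (.inr (.inl h'))
  · exact .inr (.inr (.inr h'))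

theorem IsStudiedGraph.of_two_le_minDegree (hG : IsStudiedGraph G) (h : 2 ≤ G.minDegree) :
    Nonempty (graphK3 ≃g G) ∨ Nonempty (graphC4Diag ≃g G) ∨ Nonempty (graphC4 ≃g G) := by
  rcases hG with h' | ⟨⟨e⟩⟩ | h' | h' | ⟨⟨e⟩⟩ | ⟨⟨e⟩⟩ | ⟨⟨e⟩⟩
  · exact .inl h'
  · rw [← e.minDegree_eq, minDegree_graphP2] at h
    omega
  · exact .inr (.inl h')
  · exact .inr (.inr h')
  · rw [← e.minDegree_eq, minDegree_graphP3] at h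
    omega
  · rw [← e.minDegree_eq, minDegree_graphK3Tail] at h
    omega
  · rw [← e.minDegree_eq, minDegree_graphY] at h
    omega

end MinDegree

/-! ### Proof of the theorem -/

section Main

variable {n : ℕ} {G : SimpleGraph (Fin n)} {t : ∀ (F : Type) [Field F] [Fintype F], F}

theorem VertexBound.iso {F : Type} [Field F] [Fintype F] {d m : ℕ} {t : F}
    {G₀ : SimpleGraph (Fin m)} (e : G₀ ≃g G) {C : ℝ}
    (h : VertexBound (graphWeight (d := d) t G₀) C) :
    VertexBound (graphWeight (d := d) t G) C := by
  refine VertexBound.reindex e.toEquiv ?_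
  simpa only [graphWeight_iso t e] using h

/-- A uniform bound for the graphs with a vertex of degree one. -/
theorem exists_vertexBound (ht : ∀ (F : Type) [Field F] [Fintype F], t F ≠ 0)
    (hG : Nonempty (graphP2 ≃g G) ∨ Nonempty (graphP3 ≃g G) ∨ Nonempty (graphK3Tail ≃g G) ∨
      Nonempty (graphY ≃g G)) :
    ∃ C : ℝ≥0, ∀ (F : Type) [Field F] [Fintype F], IsAdmissibleField 2 F →
      VertexBound (graphWeight (d := 2) (t F) G) C := by
  refine ⟨217 ^ 3, fun F _ _ hF => ?_⟩
  have h3 := hF.2 rfl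
  obtain ⟨v1, v2, v3⟩ := vertexBound_trees hF.1 (ht F)
  rcases hG with ⟨⟨e⟩⟩ | ⟨⟨e⟩⟩ | ⟨⟨e⟩⟩ | ⟨⟨e⟩⟩
  · exact (v1.iso e).mono (by norm_num)
  · exact (v2.iso e).mono (by norm_num)
  · exact ((vertexBound_triangles hF.1 h3 (ht F)).iso e).mono (by norm_num)
  · exact (v3.iso e).mono (by norm_num)

/-- The necessary conditions for the graphs without vertices of degree one. -/
theorem FormBounded.mem_exponentRegion (ht : ∀ (F : Type) [Field F] [Fintype F], t F ≠ 0)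
    (hG : Nonempty (graphK3 ≃g G) ∨ Nonempty (graphC4Diag ≃g G) ∨ Nonempty (graphC4 ≃g G))
    {p : Fin n → ℝ≥0∞} (hp : ∀ i, 1 ≤ p i) (h : FormBounded 2 t G p) :
    (fun i => (p i).toReal⁻¹) ∈ exponentRegion (Fin n) := by
  rcases hG with ⟨⟨e⟩⟩ | ⟨⟨e⟩⟩ | ⟨⟨e⟩⟩
  · exact mem_exponentRegion_of_comp e.toEquiv
      (mem_exponentRegion_of_formBounded_K3 ht (fun i => hp _) (h.iso e))
  · exact mem_exponentRegion_of_comp e.toEquiv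
      (mem_exponentRegion_of_formBounded_C4Diag ht (fun i => hp _) (h.iso e))
  · exact mem_exponentRegion_of_comp e.toEquiv
      (mem_exponentRegion_of_formBounded_C4 ht (fun i => hp _) (h.iso e))

/-- The reciprocals (1/2, 1/2, 1/2, 0) are the vertex exponent of the triangle, so the full bound,
and with it the restricted one, is available there. -/
theorem IsExceptionalEndpoint.mem_exponentRegion {G' : SimpleGraph (Fin n)} {p : Fin n → ℝ≥0∞}
    (h : IsExceptionalEndpoint G G' p) :
    (fun i => (p i).toReal⁻¹) ∈ exponentRegion (Fin n) := by
  obtain ⟨σ, -, -, hp⟩ := h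
  refine mem_exponentRegion_of_comp σ ?_
  have : (fun i => (p i).toReal⁻¹) ∘ σ = vertexExponent {0, 1, 2} := by
    ext i
    simp only [Function.comp_apply, hp]
    have hc : ({0, 1, 2} : Finset (Fin 4)).card = 3 := by decide
    fin_cases i <;> simp [vertexExponent, hc] <;> norm_num
  rw [this]
  exact vertexExponent_mem_exponentRegion (by decide)

end Main

theorem theorem10p7 (t : ∀ (F : Type) [Field F] [Fintype F], F)
    (ht : ∀ (F : Type) [Field F] [Fintype F], t F ≠ 0)
    (n : ℕ) (hn : n = 3 ∨ n = 4)
    (G G' : SimpleGraph (Fin n)) [DecidableRel G.Adj] [DecidableRel G'.Adj]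
    (hG : IsStudiedGraph G) (hG' : IsStudiedGraph G') (hsub : G' ≤ G)
    (hδ : min G.minDegree 2 > G'.minDegree)
    (p : Fin n → ℝ≥0∞) (hp : ∀ i, 1 ≤ p i) :
    (FormBounded 2 t G p → ¬ IsExceptionalEndpoint G G' p → FormBounded 2 t G' p) ∧
      (IsExceptionalEndpoint G G' p → FormRestrictedBounded 2 t G' p) := by
  -- Since δ(G') ≥ 1, the degree condition leaves only δ(G') = 1 and δ(G) ≥ 2.
  have h1 := hG'.one_le_minDegree
  have hC := exists_vertexBound ht (hG'.of_minDegree_le_one (by omega))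
  refine ⟨fun h _ => ?_, fun h => ?_⟩
  · exact formBounded_of_mem_exponentRegion hp hC
      (h.mem_exponentRegion ht (hG.of_two_le_minDegree (by omega)) hp)
  · exact (formBounded_of_mem_exponentRegion hp hC h.mem_exponentRegion).formRestrictedBounded
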